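/- Let $I=[\alpha,\beta]\subset\mathbb R$ ($\alpha<\beta$) be a compact interval, let $s\in(0,1)$, and let $\mathcal H^s$ denote $s$-dimensional Hausdorff measure. Let $f:I\to\mathbb R$ be a $C^{2}$ function (with one-sided derivatives at the endpoints) and let $\mathcal C=\{(x,f(x)):x\in I\}$ be its graph. Assume that $\mathcal C$ is non-degenerate with respect to $\mathcal H^s$, that is, $\mathcal H^s(\{x\in I: f''(x)=0\})=0$. Let $\lambda:\mathbb R^2\to\mathbb R$ be a function whose restriction to $\mathcal C$ is $C^{2}$, i.e. $x\mapsto\lambda(x,f(x))$ is $C^{2}$ on $I$. Let $\psi:\mathbb N\to(0,\infty)$ be decreasing with $\psi(n)\to0$ as $n\to\infty$, where $\mathbb N=\{1,2,\dots\}$. For $\mathbf a=(a_1,a_2)\in\mathbb Z^2$ write $|\mathbf a|=\max\{|a_1|,|a_2|\}$, and let $W(\mathcal C,\lambda,\psi)$ be the set of $x\in I$ such that $$|a_2f(x)+a_1x+a_0+\lambda(x,f(x))|<\psi(|\mathbf a|)$$ for infinitely many $(a_0,\mathbf a)\in\mathbb Z\times(\mathbb Z^2\setminus\{\mathbf 0\})$.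 If $$\sum_{q=1}^{\infty}\psi(q)^s\,q^{2-s}<\infty,$$ then $\mathcal H^s(W(\mathcal C,\lambda,\psi))=0$. -/

import Mathlib

open Set Filter Topology MeasureTheory

/-- `ψ : ℕ → ℝ⁺` is an approximating function: positive, decreasing (in the weak sense), and
`ψ(n) → 0`.  Only the values at `n = 1, 2, 3, …` are restricted (the value at `0` is never used). -/
structure IsApproximatingFunction (ψ : ℕ → ℝ) : Prop where
  pos : ∀ n, 1 ≤ n → 0 < ψ n
  anti : ∀ m n, 1 ≤ m → m ≤ n → ψ n ≤ ψ m
  tendsto_zero : Tendsto ψ atTop (𝓝 0)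

/-- The supremum norm `|𝐚| = max(|a₁|, |a₂|)` of an integer pair, as a natural number. -/
def supNorm (a : ℤ × ℤ) : ℕ := max a.1.natAbs a.2.natAbs

/-- The graph of a `C²` function `f` on the compact interval `[α, β]` is non-degenerate with
respect to `H^s`: the set of parameters in `[α, β]` where `f''` vanishes (one-sided derivatives
at the endpoints) is `H^s`-null. -/
def IsNondegenerateCurve (s α β : ℝ) (f : ℝ → ℝ) : Prop :=
  ContDiffOn ℝ 2 f (Icc α β) ∧
    μH[s] {x ∈ Icc α β | iteratedDerivWithin 2 f (Icc α β) x = 0} = 0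

/-- The set of `x ∈ [α, β]` such that `|a₂ f(x) + a₁ x + a₀ + lam(x, f(x))| < ψ(|𝐚|)` for
infinitely many `(a₀, 𝐚) = (a₀, (a₁, a₂)) ∈ ℤ × (ℤ² ∖ {0})`. -/
def dualApproxSet (α β : ℝ) (f : ℝ → ℝ) (lam : ℝ × ℝ → ℝ) (ψ : ℕ → ℝ) : Set ℝ :=
  {x ∈ Icc α β | {p : ℤ × (ℤ × ℤ) | p.2 ≠ 0 ∧
    |(p.2.2 : ℝ) * f x + (p.2.1 : ℝ) * x + (p.1 : ℝ) + lam (x, f x)| < ψ (supNorm p.2)}.Infinite}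

/-! The set of exceptional parameters where `f'' = 0` is null by hypothesis, so the claim is local at
points where `f'' ≠ 0`, and after a reflection `f'' > 0` (`exists_convexArc`). On such an arc the
theorem, `arcApproxSet_null`, follows from the Borel–Cantelli lemma for `H^s`, applied to the
sublevel sets `{|F + a₀| < ψ(q)}`, where `F = a₂ f + a₁ x + l` and `q = |(a₁, a₂)|`. For large `q`
the function `F` either has a derivative of size `q`, or its derivative is monotone with slope of
order `q` and it has a single turning point `z` (`exists_turning_point`).

In the first case each of the `O(q)` relevant translates has a sublevel set of length `O(ψ / q)`. In
the second, if `F + a₀` has size about `|k|` at `z`, the sublevel set has length `ψ / (q |k|)^{1/2}`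
on either side of `z`, for `0 < |k| ≤ O(q)`. Both sums cost `ψ^s q^{1-s}` for one pair `(a₁, a₂)`.
There are `O(q)` pairs of norm `q`, and the resulting sum is the series of the hypothesis. The translate
nearest to zero at `z` is the exception. Unless it has nearly a double zero at `z`, in a sense that
depends on a parameter `t ≥ 1`, its sublevel sets have length `O(ψ t²)`, and with `t` a small power
of `q` this is absorbed in the same series. If it has nearly a double zero, only the length
`(ψ / q)^{1/2}` is available. As `ψ` is decreasing, convergence of the series gives
`ψ(q)^s q^{3-s} = O(1)`, so that the cost is `O(q^{-3/2})` (`tsum_ediam_le`). It is therefore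
enough that only `O(Q^{3/2} / t)` pairs of norm at most `Q` are of this exceptional kind; since `t`
is a power of `Q`, the sum over dyadic `Q` is then geometric (`summable_nearPairs`).

This count, `card_nearPairs_le_div`, is the heart of the proof. The number of pairs is estimated in
cells of length `X / Q`. Differences of the pairs in one cell are coefficients of homogeneous
integer forms, free of `l`, that lie in a box of small volume, so any three of them are linearly
dependent. By `line_or_plane` a cell with `M` pairs thus yields either a form that is smaller than
the box by the factor `M` (a line), or, from the normal vector of a plane, a rational point of small
denominator close to the cell. Counting the possible forms and rational points bounds the number of
cells with at least `M` pairs (`exists_cells`), and summation over `M` bounds the number of pairs.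
Counting all forms trivially gives `O(Q^{3/2})` (`card_nearPairs_le`). The forms that occur are
themselves exceptional for `l = 0`, so this first bound can be fed back into the argument
(`sum_smallForm_le`), which gains the factor `t`. -/

/-! ### Counting separated points -/

theorem card_le_of_separated {ι : Type*} (s : Finset ι) (x : ι → ℝ) {σ L : ℝ} (hσ : 0 < σ)
    (hL0 : 0 ≤ L) (hsep : ∀ i ∈ s, ∀ j ∈ s, i ≠ j → σ ≤ |x i - x j|)
    (hL : ∀ i ∈ s, ∀ j ∈ s, x i - x j ≤ L) : (s.card : ℝ) ≤ L / σ + 1 := by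
  rcases s.eq_empty_or_nonempty with rfl | hne
  · simp only [Finset.card_empty, Nat.cast_zero]; positivity
  obtain ⟨i0, hi0, hmin⟩ := s.exists_min_image x hne
  have hmaps : ∀ i ∈ s, ⌊(x i - x i0) / σ⌋₊ ∈ Finset.range (⌊L / σ⌋₊ + 1) := by
    intro i hi
    rw [Finset.mem_range, Nat.lt_succ_iff]
    exact Nat.floor_mono (by gcongr; exact hL i hi i0 hi0)
  have hinj : Set.InjOn (fun i => ⌊(x i - x i0) / σ⌋₊) s := by
    intro i hi j hj hij
    by_contra hne
    have h1 := hsep i hi j hj hne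
    have hi' : 0 ≤ (x i - x i0) / σ := div_nonneg (sub_nonneg.2 (hmin i hi)) hσ.le
    have hj' : 0 ≤ (x j - x i0) / σ := div_nonneg (sub_nonneg.2 (hmin j hj)) hσ.le
    simp only at hij
    have a1 := Nat.floor_le hi'
    have a2 := Nat.lt_floor_add_one ((x i - x i0) / σ)
    have b1 := Nat.floor_le hj'
    have b2 := Nat.lt_floor_add_one ((x j - x i0) / σ)
    rw [hij] at a1 a2
    have h2 : |(x i - x i0) / σ - (x j - x i0) / σ| < 1 := by
      rw [abs_lt]; constructor <;> linarith
    rw [← sub_div, abs_div, abs_of_pos hσ, div_lt_one hσ] at h2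
    have : x i - x i0 - (x j - x i0) = x i - x j := by ring
    rw [this] at h2
    linarith
  have hc := Finset.card_le_card_of_injOn _ hmaps hinj
  rw [Finset.card_range] at hc
  calc (s.card : ℝ) ≤ ((⌊L / σ⌋₊ + 1 : ℕ) : ℝ) := by exact_mod_cast hc
    _ ≤ L / σ + 1 := by push_cast; gcongr; exact Nat.floor_le (by positivity)

/-- A finite set of integer points of `[-T, T]²` all of whose pairwise determinants are divisible
by `T` has `O(T)` elements: its reduction modulo `T` is an isotropic subset of the symplectic
plane over `ℤ/T`, so it has at most `T` classes. -/
theorem card_le_of_dvd_cross (S : Finset (ℤ × ℤ)) (T : ℤ) (hT : 1 ≤ T)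
    (hb : ∀ p ∈ S, |p.1| ≤ T ∧ |p.2| ≤ T)
    (hd : ∀ p ∈ S, ∀ p' ∈ S, T ∣ p.1 * p'.2 - p'.1 * p.2) : (S.card : ℝ) ≤ 11 * (T : ℝ) := by
  classical
  have hTR : (1 : ℝ) ≤ T := by exact_mod_cast hT
  by_cases hrow : ∃ p ∈ S, ∃ p' ∈ S, p.1 = p'.1 ∧ p.2 < p'.2
  · -- `e` is the smallest gap between two points with the same first coordinate
    let P : Finset ((ℤ × ℤ) × (ℤ × ℤ)) := (S ×ˢ S).filter fun x => x.1.1 = x.2.1 ∧ x.1.2 < x.2.2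
    have hP : P.Nonempty := by
      obtain ⟨p, hp, p', hp', h1, h2⟩ := hrow
      exact ⟨(p, p'), by simp [P, hp, hp', h1, h2]⟩
    obtain ⟨⟨w1, w2⟩, hw, hwmin⟩ := P.exists_min_image (fun x => x.2.2 - x.1.2) hP
    simp only [P, Finset.mem_filter, Finset.mem_product] at hw hwmin
    obtain ⟨⟨hw1, hw2⟩, hweq, hwlt⟩ := hw
    set e : ℤ := w2.2 - w1.2 with he
    have he1 : 1 ≤ e := by omega
    have he2 : e ≤ 2 * T := by
      have := abs_le.1 (hb w1 hw1).2
      have := abs_le.1 (hb w2 hw2).2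
      omega
    have heR : (1 : ℝ) ≤ e := by exact_mod_cast he1
    have he2R : (e : ℝ) ≤ 2 * T := by exact_mod_cast he2
    have hrows : ∀ i ∈ S.image Prod.fst,
        ((S.filter fun p => p.1 = i).card : ℝ) ≤ 2 * T / e + 1 := by
      intro i _
      refine card_le_of_separated _ (fun p => (p.2 : ℝ)) (by linarith) (by linarith) ?_ ?_
      · intro p hp p' hp' hne
        simp only [Finset.mem_filter] at hp hp'
        have hne2 : p.2 ≠ p'.2 := fun h => hne (Prod.ext (hp.2.trans hp'.2.symm) h)
        have : e ≤ |p.2 - p'.2| := by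
          rcases lt_or_gt_of_ne hne2 with h | h
          · have := hwmin (p, p') ⟨⟨hp.1, hp'.1⟩, hp.2.trans hp'.2.symm, h⟩
            simp only at this
            rw [abs_sub_comm]; exact this.trans (le_abs_self _)
          · have := hwmin (p', p) ⟨⟨hp'.1, hp.1⟩, hp'.2.trans hp.2.symm, h⟩
            simp only at this
            exact this.trans (le_abs_self _)
        exact_mod_cast this
      · intro p hp p' hp'
        simp only [Finset.mem_filter] at hp hp'
        have h1 := abs_le.1 (hb p hp.1).2
        have h2 := abs_le.1 (hb p' hp'.1).2
        have : p.2 - p'.2 ≤ 2 * T := by omega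
        exact_mod_cast this
    have hcols : ((S.image Prod.fst).card : ℝ) ≤ 2 * T / (T / e) + 1 := by
      refine card_le_of_separated _ (fun i : ℤ => (i : ℝ)) (by positivity) (by linarith) ?_ ?_
      · intro i hi j hj hij
        obtain ⟨p, hp, rfl⟩ := Finset.mem_image.1 hi
        obtain ⟨p', hp', rfl⟩ := Finset.mem_image.1 hj
        have hdvd : T ∣ (p.1 - p'.1) * e := by
          have h1 := hd p hp w2 hw2
          have h2 := hd p hp w1 hw1
          have h3 := hd p' hp' w2 hw2
          have h4 := hd p' hp' w1 hw1
          have := dvd_sub (dvd_sub h1 h2) (dvd_sub h3 h4)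
          have heq : (p.1 - p'.1) * e = p.1 * w2.2 - w2.1 * p.2 - (p.1 * w1.2 - w1.1 * p.2)
              - (p'.1 * w2.2 - w2.1 * p'.2 - (p'.1 * w1.2 - w1.1 * p'.2)) := by
            rw [he]; linear_combination (p'.2 - p.2) * hweq
          rwa [heq]
        have hne : (p.1 - p'.1) * e ≠ 0 := mul_ne_zero (sub_ne_zero.2 hij) (by omega)
        have hle : T ≤ |p.1 - p'.1| * e := by
          have := Int.le_of_dvd (abs_pos.2 hne) ((dvd_abs _ _).2 hdvd)
          rwa [abs_mul, abs_of_pos (by omega : 0 < e)] at this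
        rw [div_le_iff₀ (by linarith)]
        exact_mod_cast hle
      · intro i hi j hj
        obtain ⟨p, hp, rfl⟩ := Finset.mem_image.1 hi
        obtain ⟨p', hp', rfl⟩ := Finset.mem_image.1 hj
        have h1 := abs_le.1 (hb p hp).1
        have h2 := abs_le.1 (hb p' hp').1
        have : p.1 - p'.1 ≤ 2 * T := by omega
        exact_mod_cast this
    have hcols' : ((S.image Prod.fst).card : ℝ) ≤ 2 * e + 1 := by
      have : 2 * (T : ℝ) / (T / e) = 2 * e := by field_simp
      rwa [this] at hcols
    have hsum : (S.card : ℝ) ≤ (2 * e + 1) * (2 * T / e + 1) := by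
      rw [Finset.card_eq_sum_card_image Prod.fst S]
      push_cast
      calc _ ≤ ∑ _i ∈ S.image Prod.fst, (2 * (T : ℝ) / e + 1) := Finset.sum_le_sum hrows
        _ = (S.image Prod.fst).card * (2 * (T : ℝ) / e + 1) := by rw [Finset.sum_const, nsmul_eq_mul]
        _ ≤ _ := by gcongr
    have h1 : (2 * (e : ℝ) + 1) * (2 * T / e + 1) = 4 * T + 2 * e + 2 * T / e + 1 := by
      field_simp
      ring
    have h2 : 2 * (T : ℝ) / e ≤ 2 * T := div_le_self (by linarith) heR
    linarith
  · push Not at hrow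
    have := card_le_of_separated S (fun p => (p.1 : ℝ)) one_pos
      (by linarith : (0 : ℝ) ≤ 2 * T) ?_ ?_
    · linarith
    · intro p hp p' hp' hne
      have h1 : p.1 ≠ p'.1 := by
        intro h
        exact hne (Prod.ext h (le_antisymm (hrow p' hp' p hp h.symm) (hrow p hp p' hp' h)))
      have : 1 ≤ |p.1 - p'.1| := Int.one_le_abs (sub_ne_zero.2 h1)
      exact_mod_cast this
    · intro p hp p' hp'
      have h1 := abs_le.1 (hb p hp).1
      have h2 := abs_le.1 (hb p' hp').1
      have : p.1 - p'.1 ≤ 2 * T := by omega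
      exact_mod_cast this

/-! ### Integer linear forms with small value and derivative -/

/-- The integer linear form `g₀ + g₁ X + g₂ Y`, `g = (g₀, (g₁, g₂))`, has at a point `(y, φ)` with
slope `φ₁` of a curve value at most `U`, derivative at most `V`, and `|g₂| ≤ W`. -/
def FormBox (y φ φ₁ U V W : ℝ) (g : ℤ × (ℤ × ℤ)) : Prop :=
  |(g.2.2 : ℝ) * φ + g.2.1 * y + g.1| ≤ U ∧ |(g.2.2 : ℝ) * φ₁ + g.2.1| ≤ V ∧ |(g.2.2 : ℝ)| ≤ W

/-- In a box with `U, V < 1` only the zero form has last coefficient zero. -/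
theorem FormBox.eq_zero {y φ φ₁ U V W : ℝ} {g : ℤ × (ℤ × ℤ)} (hg : FormBox y φ φ₁ U V W g)
    (hU : U < 1) (hV : V < 1) (h0 : g.2.2 = 0) : g = 0 := by
  obtain ⟨h1, h2, -⟩ := hg
  rw [h0] at h1 h2
  have h3 : g.2.1 = 0 := by
    simp only [Int.cast_zero, zero_mul, zero_add] at h2
    exact Int.abs_lt_one_iff.1 (by exact_mod_cast h2.trans_lt hV)
  rw [h3] at h1
  have h4 : g.1 = 0 := by
    simp only [Int.cast_zero, zero_mul, zero_add] at h1
    exact Int.abs_lt_one_iff.1 (by exact_mod_cast h1.trans_lt hU)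
  exact Prod.ext h4 (Prod.ext h3 h0)

theorem abs_sub_mul_le {a b c d U V : ℝ} (ha : |a| ≤ U) (hb : |b| ≤ V) (hc : |c| ≤ U)
    (hd : |d| ≤ V) : |a * b - c * d| ≤ 2 * U * V := by
  have hU : 0 ≤ U := (abs_nonneg _).trans ha
  have h1 : |a * b| ≤ U * V := by rw [abs_mul]; gcongr
  have h2 : |c * d| ≤ U * V := by rw [abs_mul]; gcongr
  calc |a * b - c * d| ≤ |a * b| + |c * d| := abs_sub _ _
    _ ≤ 2 * U * V := by linarith

/-- The two-dimensional determinant of the coefficients `(g₁, g₂)` of two forms. -/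
def crossQ (g h : ℤ × (ℤ × ℤ)) : ℤ := g.2.1 * h.2.2 - g.2.2 * h.2.1

/-- The two-dimensional determinant of the coefficients `(g₀, g₂)` of two forms. -/
def crossP (g h : ℤ × (ℤ × ℤ)) : ℤ := g.1 * h.2.2 - g.2.2 * h.1

/-- The two-dimensional determinant of the coefficients `(g₀, g₁)` of two forms. -/
def crossO (g h : ℤ × (ℤ × ℤ)) : ℤ := g.1 * h.2.1 - g.2.1 * h.1

section
variable {y φ φ₁ U V W : ℝ} {g h k : ℤ × (ℤ × ℤ)}

theorem FormBox.crossQ_le (hg : FormBox y φ φ₁ U V W g) (hh : FormBox y φ φ₁ U V W h) :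
    |(crossQ g h : ℝ)| ≤ 2 * V * W := by
  have := abs_sub_mul_le hg.2.1 hh.2.2 hh.2.1 hg.2.2
  convert this using 2
  simp only [crossQ]; push_cast; ring

theorem FormBox.crossP_le (hg : FormBox y φ φ₁ U V W g) (hh : FormBox y φ φ₁ U V W h) :
    |(crossQ g h : ℝ) * y + crossP g h| ≤ 2 * U * W := by
  have := abs_sub_mul_le hg.1 hh.2.2 hh.1 hg.2.2
  convert this using 2
  simp only [crossQ, crossP]; push_cast; ring

/-- Three forms in a box of small volume are linearly dependent: their determinant is an integer of
absolute value less than one. -/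
theorem FormBox.det_eq_zero (hg : FormBox y φ φ₁ U V W g) (hh : FormBox y φ φ₁ U V W h)
    (hk : FormBox y φ φ₁ U V W k) (hsmall : 6 * U * V * W < 1) :
    g.1 * crossQ h k - g.2.1 * crossP h k + g.2.2 * crossO h k = 0 := by
  rw [← Int.abs_lt_one_iff]
  have hU : 0 ≤ U := (abs_nonneg _).trans hg.1
  set u1 := (g.2.2 : ℝ) * φ + g.2.1 * y + g.1 with hu1
  set u2 := (h.2.2 : ℝ) * φ + h.2.1 * y + h.1 with hu2
  set u3 := (k.2.2 : ℝ) * φ + k.2.1 * y + k.1 with hu3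
  have e1 := hh.crossQ_le hk
  have e2 := hk.crossQ_le hg
  have e3 := hg.crossQ_le hh
  have key : ((g.1 * crossQ h k - g.2.1 * crossP h k + g.2.2 * crossO h k : ℤ) : ℝ)
      = u1 * crossQ h k + u2 * crossQ k g + u3 * crossQ g h := by
    rw [hu1, hu2, hu3]
    simp only [crossQ, crossP, crossO]; push_cast; ring
  have : |((g.1 * crossQ h k - g.2.1 * crossP h k + g.2.2 * crossO h k : ℤ) : ℝ)| < 1 := by
    rw [key]
    have m1 : |u1 * crossQ h k| ≤ U * (2 * V * W) := by
      rw [abs_mul]; exact mul_le_mul hg.1 e1 (abs_nonneg _) hU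
    have m2 : |u2 * crossQ k g| ≤ U * (2 * V * W) := by
      rw [abs_mul]; exact mul_le_mul hh.1 e2 (abs_nonneg _) hU
    have m3 : |u3 * crossQ g h| ≤ U * (2 * V * W) := by
      rw [abs_mul]; exact mul_le_mul hk.1 e3 (abs_nonneg _) hU
    calc _ ≤ |u1 * crossQ h k| + |u2 * crossQ k g| + |u3 * crossQ g h| := abs_add_three _ _ _
      _ < 1 := by nlinarith
  exact_mod_cast this

theorem FormBox.crossP_eq_zero (hg : FormBox y φ φ₁ U V W g) (hh : FormBox y φ φ₁ U V W h)
    (hUW : 2 * U * W < 1) (hq : crossQ g h = 0) : crossP g h = 0 := by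
  have := hg.crossP_le hh
  rw [hq, Int.cast_zero, zero_mul, zero_add] at this
  exact Int.abs_lt_one_iff.1 (by exact_mod_cast this.trans_lt hUW)

end

/-- Three integers, the first nonzero, divided by their greatest common divisor, satisfy a Bézout
identity. -/
theorem exists_primitive_triple (a b c : ℤ) (ha : a ≠ 0) :
    ∃ d a' b' c' x y z : ℤ, 0 < d ∧ a = d * a' ∧ b = d * b' ∧ c = d * c' ∧
      x * a' + y * b' + z * c' = 1 := by
  set e : ℤ := (Int.gcd a b : ℤ)
  set d : ℤ := (Int.gcd e c : ℤ)
  have he : e ≠ 0 := by simp [e, Int.gcd_eq_zero_iff, ha]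
  have hd0 : 0 < d := by
    have : d ≠ 0 := by simp only [d, ne_eq, Nat.cast_eq_zero, Int.gcd_eq_zero_iff]; tauto
    have : 0 ≤ d := Int.natCast_nonneg _
    omega
  have hde : d ∣ e := Int.gcd_dvd_left ..
  obtain ⟨a', ha'⟩ : d ∣ a := hde.trans (Int.gcd_dvd_left ..)
  obtain ⟨b', hb'⟩ : d ∣ b := hde.trans (Int.gcd_dvd_right ..)
  obtain ⟨c', hc'⟩ : d ∣ c := Int.gcd_dvd_right ..
  have h1 : e = a * Int.gcdA a b + b * Int.gcdB a b := Int.gcd_eq_gcd_ab a b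
  have h2 : d = e * Int.gcdA e c + c * Int.gcdB e c := Int.gcd_eq_gcd_ab e c
  refine ⟨d, a', b', c', Int.gcdA a b * Int.gcdA e c, Int.gcdB a b * Int.gcdA e c,
    Int.gcdB e c, hd0, ha', hb', hc', ?_⟩
  apply mul_left_cancel₀ hd0.ne'
  generalize Int.gcdA e c = s at *
  generalize Int.gcdB e c = t at *
  generalize Int.gcdA a b = s' at *
  generalize Int.gcdB a b = t' at *
  calc d * (s' * s * a' + t' * s * b' + t * c')
      = ((d * a') * s' + (d * b') * t') * s + (d * c') * t := by ring
    _ = d * 1 := by rw [← ha', ← hb', ← hc', ← h1, ← h2, mul_one]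

/-- **Line or plane.** Let all differences of the elements of `S` lie in a box whose volume is so
small that triples of differences are linearly dependent.  If the elements of `S` are collinear,
the smallest difference is a form that is smaller than the box by the factor `#S - 1`.
Otherwise they span a plane; its primitive normal vector yields a rational point `-r / q`, and the
count of `S` in terms of the covolume of the plane makes `q` and `q y + r` small. -/
theorem line_or_plane {y φ φ₁ U V W : ℝ} (S : Finset (ℤ × (ℤ × ℤ))) (hS : 2 ≤ S.card)
    (hbox : ∀ a ∈ S, ∀ b ∈ S, FormBox y φ φ₁ U V W (a - b)) (hU : U < 1) (hV : V < 1)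
    (hUW : 2 * U * W < 1) (hUVW : 6 * U * V * W < 1) :
    (∃ g : ℤ × (ℤ × ℤ), 0 < g.2.2 ∧
      ((S.card : ℝ) - 1) * |(g.2.2 : ℝ) * φ + g.2.1 * y + g.1| ≤ U ∧
      ((S.card : ℝ) - 1) * |(g.2.2 : ℝ) * φ₁ + g.2.1| ≤ V ∧
      ((S.card : ℝ) - 1) * g.2.2 ≤ W) ∨
    (∃ q r : ℤ, 0 < q ∧ (S.card : ℝ) * q ≤ 22 * V * W ∧ (S.card : ℝ) * |q * y + r| ≤ 22 * U * W) := by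
  classical
  have hne : S.Nonempty := Finset.card_pos.1 (by omega)
  obtain ⟨a, ha⟩ := hne
  have hW : 0 ≤ W := (abs_nonneg _).trans (hbox a ha a ha).2.2
  have hinj2 : ∀ b ∈ S, ∀ c ∈ S, b.2.2 = c.2.2 → b = c := by
    intro b hb c hc hbc
    exact sub_eq_zero.1 ((hbox b hb c hc).eq_zero hU hV (by simp [hbc]))
  by_cases hplane : ∃ b ∈ S, ∃ c ∈ S, crossQ (b - a) (c - a) ≠ 0
  · right
    obtain ⟨⟨b, c⟩, hbc, hmax'⟩ := (S ×ˢ S).exists_max_image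
      (fun x => |crossQ (x.1 - a) (x.2 - a)|) ⟨(a, a), by simp [ha]⟩
    obtain ⟨hb, hc⟩ := Finset.mem_product.1 hbc
    have hmax : ∀ b' ∈ S, ∀ c' ∈ S,
        |crossQ (b' - a) (c' - a)| ≤ |crossQ (b - a) (c - a)| := fun b' hb' c' hc' =>
      hmax' (b', c') (Finset.mem_product.2 ⟨hb', hc'⟩)
    set u := b - a with hu
    set v := c - a with hv
    have hq0 : crossQ u v ≠ 0 := by
      obtain ⟨b', hb', c', hc', h0⟩ := hplane
      exact abs_pos.1 ((abs_pos.2 h0).trans_le (hmax b' hb' c' hc'))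
    obtain ⟨d, q, p, o, x, z, w, hd, hqd, hpd, hod, hbez⟩ :=
      exists_primitive_triple (crossQ u v) (crossP u v) (crossO u v) hq0
    have hqne : q ≠ 0 := by rintro rfl; simp at hqd; exact hq0 hqd
    -- all differences from `a` are orthogonal to the normal vector `(q, -p, o)`
    have horth : ∀ g ∈ S, (g - a).1 * q - (g - a).2.1 * p + (g - a).2.2 * o = 0 := by
      intro g hg
      have h1 := (hbox g hg a ha).det_eq_zero (hbox b hb a ha) (hbox c hc a ha) hUVW
      rw [← hu, ← hv, hqd, hpd, hod] at h1
      apply mul_left_cancel₀ hd.ne'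
      linear_combination h1
    -- the integral area form on the plane, in units of the covolume
    let τ : ℤ × (ℤ × ℤ) → ℤ × (ℤ × ℤ) → ℤ := fun g h =>
      x * crossQ g h + z * crossP g h + w * crossO g h
    have hτ : ∀ g ∈ S, ∀ h ∈ S, crossQ (g - a) (h - a) = τ (g - a) (h - a) * q := by
      intro g hg h hh
      have h1 := horth g hg
      have h2 := horth h hh
      generalize g - a = G at *
      generalize h - a = H at *
      have e1 : crossQ G H * p = crossP G H * q := by
        simp only [crossQ, crossP]
        linear_combination (-H.2.2) * h1 + G.2.2 * h2
      have e2 : crossQ G H * o = crossO G H * q := by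
        simp only [crossQ, crossO]
        linear_combination (-H.2.1) * h1 + G.2.1 * h2
      calc crossQ G H = crossQ G H * (x * q + z * p + w * o) := by rw [hbez, mul_one]
        _ = _ := by
          simp only [τ]
          linear_combination z * e1 + w * e2
    let ι : ℤ × (ℤ × ℤ) → ℤ × ℤ := fun g => (τ (g - a) v, τ u (g - a))
    have hιinj : Set.InjOn ι S := by
      intro g hg h hh hgh
      simp only [ι, Prod.mk.injEq] at hgh
      have h1 : crossQ (g - a) v = crossQ (h - a) v := by
        rw [hv, hτ g hg c hc, hτ h hh c hc, ← hv, hgh.1]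
      have h2 : crossQ u (g - a) = crossQ u (h - a) := by
        rw [hu, hτ b hb g hg, hτ b hb h hh, ← hu, hgh.2]
      apply hinj2 g hg h hh
      have h3 : (g - a).2.2 = (h - a).2.2 := by
        apply mul_left_cancel₀ hq0
        generalize g - a = G at *
        generalize h - a = H at *
        simp only [crossQ] at *
        linear_combination u.2.2 * h1 + v.2.2 * h2
      simpa using h3
    have hcard : (S.card : ℝ) ≤ 11 * (d : ℝ) := by
      rw [← Finset.card_image_of_injOn hιinj]
      apply card_le_of_dvd_cross _ _ hd
      · intro i hi
        obtain ⟨g, hg, rfl⟩ := Finset.mem_image.1 hi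
        have hqpos : 0 < |q| := abs_pos.2 hqne
        constructor
        · have := hmax g hg c hc
          rw [hτ g hg c hc, hqd, abs_mul, abs_mul, abs_of_pos hd] at this
          exact le_of_mul_le_mul_right this hqpos
        · have := hmax b hb g hg
          rw [hτ b hb g hg, hqd, abs_mul, abs_mul, abs_of_pos hd] at this
          exact le_of_mul_le_mul_right this hqpos
      · intro i hi j hj
        obtain ⟨g, hg, rfl⟩ := Finset.mem_image.1 hi
        obtain ⟨h, hh, rfl⟩ := Finset.mem_image.1 hj
        refine ⟨τ (g - a) (h - a), ?_⟩
        have e1 := hτ g hg c hc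
        have e2 := hτ b hb g hg
        have e3 := hτ h hh c hc
        have e4 := hτ b hb h hh
        have e5 := hτ g hg h hh
        rw [← hv] at e1 e3
        rw [← hu] at e2 e4
        simp only [ι]
        generalize τ (g - a) v = t1 at *
        generalize τ u (g - a) = t2 at *
        generalize τ (h - a) v = t3 at *
        generalize τ u (h - a) = t4 at *
        generalize τ (g - a) (h - a) = t5 at *
        generalize g - a = G at *
        generalize h - a = H at *
        -- the Plücker relation
        have pl : crossQ u v * crossQ G H
            = crossQ G v * crossQ u H - crossQ H v * crossQ u G := by
          simp only [crossQ]; ring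
        rw [hqd, e1, e2, e3, e4, e5] at pl
        apply mul_left_cancel₀ (mul_ne_zero hqne hqne)
        linear_combination -pl
    have hdR : (0 : ℝ) < d := by exact_mod_cast hd
    have b1 := (hbox b hb a ha).crossQ_le (hbox c hc a ha)
    have b2 := (hbox b hb a ha).crossP_le (hbox c hc a ha)
    rw [← hu, ← hv, hqd] at b1 b2
    rw [hpd] at b2
    push_cast at b1 b2
    have hb1 : (d : ℝ) * |(q : ℝ)| ≤ 2 * V * W := by rwa [abs_mul, abs_of_pos hdR] at b1
    have hb2 : (d : ℝ) * |(q : ℝ) * y + p| ≤ 2 * U * W := by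
      rwa [mul_assoc, ← mul_add, abs_mul, abs_of_pos hdR] at b2
    have c1 : (S.card : ℝ) * |(q : ℝ)| ≤ 22 * V * W := by
      nlinarith [mul_le_mul_of_nonneg_right hcard (abs_nonneg (q : ℝ))]
    have c2 : (S.card : ℝ) * |(q : ℝ) * y + p| ≤ 22 * U * W := by
      nlinarith [mul_le_mul_of_nonneg_right hcard (abs_nonneg ((q : ℝ) * y + p))]
    rcases lt_or_gt_of_ne hqne with h | h
    · refine ⟨-q, -p, by omega, ?_, ?_⟩
      · rwa [abs_of_neg (by exact_mod_cast h), ← Int.cast_neg] at c1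
      · rw [← abs_neg] at c2
        convert c2 using 3
        push_cast; ring
    · refine ⟨q, p, h, ?_, c2⟩
      rwa [abs_of_pos (by exact_mod_cast h)] at c1
  · left
    push Not at hplane
    let P : Finset ((ℤ × (ℤ × ℤ)) × (ℤ × (ℤ × ℤ))) := (S ×ˢ S).filter fun x => x.1.2.2 < x.2.2.2
    have hP : P.Nonempty := by
      obtain ⟨b, hb, c, hc, hbc⟩ := Finset.one_lt_card.1 hS
      rcases lt_or_gt_of_ne (fun h => hbc (hinj2 b hb c hc h)) with h | h
      · exact ⟨(b, c), by simp [P, hb, hc, h]⟩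
      · exact ⟨(c, b), by simp [P, hb, hc, h]⟩
    obtain ⟨⟨b, c⟩, hbc, hmin⟩ := P.exists_min_image (fun x => x.2.2.2 - x.1.2.2) hP
    simp only [P, Finset.mem_filter, Finset.mem_product, Prod.forall, and_imp] at hbc hmin
    obtain ⟨⟨hb, hc⟩, hlt⟩ := hbc
    obtain ⟨m, hm, hmmin⟩ := S.exists_min_image (fun x => x.2.2) ⟨a, ha⟩
    obtain ⟨n, hn, hnmax⟩ := S.exists_max_image (fun x => x.2.2) ⟨a, ha⟩
    set e : ℤ := c.2.2 - b.2.2 with he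
    set D : ℤ := n.2.2 - m.2.2 with hD
    have he0 : 0 < e := by omega
    have heR : (0 : ℝ) < e := by exact_mod_cast he0
    have hD0 : 0 ≤ D := by have := hmmin n hn; omega
    have hcard : (S.card : ℝ) ≤ D / e + 1 := by
      refine card_le_of_separated S (fun x => (x.2.2 : ℝ)) heR (by exact_mod_cast hD0) ?_ ?_
      · intro i hi j hj hij
        have hne2 : i.2.2 ≠ j.2.2 := fun h => hij (hinj2 i hi j hj h)
        have : e ≤ |i.2.2 - j.2.2| := by
          rcases lt_or_gt_of_ne hne2 with h | h
          · rw [abs_sub_comm]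
            exact (hmin i.1 i.2.1 i.2.2 j.1 j.2.1 j.2.2 hi hj h).trans (le_abs_self _)
          · exact (hmin j.1 j.2.1 j.2.2 i.1 i.2.1 i.2.2 hj hi h).trans (le_abs_self _)
        exact_mod_cast this
      · intro i hi j hj
        have h1 := hmmin j hj
        have h2 := hnmax i hi
        have : i.2.2 - j.2.2 ≤ D := by omega
        exact_mod_cast this
    have hcard' : ((S.card : ℝ) - 1) * e ≤ D := by
      rw [← le_div_iff₀ heR]; linarith
    have hq : ∀ g ∈ S, ∀ h ∈ S, ∀ g' ∈ S, ∀ h' ∈ S, crossQ (g - h) (g' - h') = 0 := by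
      intro g hg h hh g' hg' h' hh'
      have h1 := hplane g hg g' hg'
      have h2 := hplane g hg h' hh'
      have h3 := hplane h hh g' hg'
      have h4 := hplane h hh h' hh'
      simp only [crossQ, Prod.fst_sub, Prod.snd_sub] at *
      linear_combination h1 - h2 - h3 + h4
    have hpar1 := hq n hn m hm c hc b hb
    have hpar0 := (hbox n hn m hm).crossP_eq_zero (hbox c hc b hb) hUW hpar1
    have hboxD := hbox n hn m hm
    have hDe : (c - b).2.2 = e := by simp [he]
    have hDD : (n - m).2.2 = D := by simp [hD]
    refine ⟨c - b, by rw [hDe]; exact he0, ?_⟩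
    generalize c - b = G at *
    generalize n - m = H at *
    simp only [crossQ, crossP, hDe, hDD] at hpar1 hpar0
    have r1 : (H.2.1 : ℝ) * e = D * G.2.1 := by exact_mod_cast sub_eq_zero.1 hpar1
    have r0 : (H.1 : ℝ) * e = D * G.1 := by exact_mod_cast sub_eq_zero.1 hpar0
    have hk : (0 : ℝ) ≤ (S.card : ℝ) - 1 := by
      have : (2 : ℝ) ≤ S.card := by exact_mod_cast hS
      linarith
    have scale : ∀ (A B E : ℝ), |A| ≤ E → e * A = D * B → ((S.card : ℝ) - 1) * |B| ≤ E := by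
      intro A B E hA hAB
      have h1 : (D : ℝ) * |B| = e * |A| := by
        have hD0' : (0 : ℝ) ≤ D := by exact_mod_cast hD0
        calc (D : ℝ) * |B| = |D * B| := by rw [abs_mul, abs_of_nonneg hD0']
          _ = e * |A| := by rw [← hAB, abs_mul, abs_of_pos heR]
      have h2 := mul_le_mul_of_nonneg_right hcard' (abs_nonneg B)
      have h3 : (e : ℝ) * (((S.card : ℝ) - 1) * |B|) ≤ e * E := by
        calc _ = ((S.card : ℝ) - 1) * e * |B| := by ring
          _ ≤ D * |B| := h2
          _ = e * |A| := h1
          _ ≤ e * E := by gcongr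
      exact le_of_mul_le_mul_left h3 heR
    rw [hDe]
    rw [FormBox, hDD] at hboxD
    refine ⟨scale _ _ _ hboxD.1 ?_, scale _ _ _ hboxD.2.1 ?_, ?_⟩
    · linear_combination y * r1 + r0
    · linear_combination r1
    · exact hcard'.trans ((le_abs_self _).trans hboxD.2.2)

/-! ### Forms that nearly vanish to second order on an arc -/

/-- `l` is a `C^{1,1}` function on `[A, B]` with derivative `l₁`; the constant `C` bounds `l`, `l₁`
and the Lipschitz constant of `l₁`. -/
structure IsC11 (A B C : ℝ) (l l₁ : ℝ → ℝ) : Prop where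
  deriv : ∀ x ∈ Icc A B, HasDerivWithinAt l (l₁ x) (Icc A B) x
  bound : ∀ x ∈ Icc A B, |l x| ≤ C
  bound_deriv : ∀ x ∈ Icc A B, |l₁ x| ≤ C
  lip : ∀ x ∈ Icc A B, ∀ y ∈ Icc A B, |l₁ x - l₁ y| ≤ C * |x - y|

/-- `f` is a `C^{1,1}` function on `[A, B]` whose derivative `f₁` is increasing with slope at least
`1 / C`; for convenience `C ≥ 1` also bounds the points of `[A, B]`. -/
structure IsConvexArc (A B C : ℝ) (f f₁ : ℝ → ℝ) : Prop extends IsC11 A B C f f₁ where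
  one_le : 1 ≤ C
  abs_le : ∀ x ∈ Icc A B, |x| ≤ C
  le_sub : ∀ x ∈ Icc A B, ∀ y ∈ Icc A B, x ≤ y → y - x ≤ C * (f₁ y - f₁ x)

/-- The integer pairs `(a₁, a₂)`, `|a₂| ≤ Q`, for which some integer translate
`a₂ f + a₁ x + a₀ + l` is at most `Q ρ²` and has derivative at most `Q ρ` at a common point. -/
def nearPairs (A B : ℝ) (f f₁ l l₁ : ℝ → ℝ) (Q ρ : ℝ) : Set (ℤ × ℤ) :=
  {a | |(a.2 : ℝ)| ≤ Q ∧ ∃ x ∈ Icc A B, ∃ a₀ : ℤ,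
    |(a.2 : ℝ) * f₁ x + a.1 + l₁ x| ≤ Q * ρ ∧ |(a.2 : ℝ) * f x + a.1 * x + a₀ + l x| ≤ Q * ρ ^ 2}

theorem form_hasDeriv {A B C : ℝ} {f f₁ l l₁ : ℝ → ℝ} (hf : IsC11 A B C f f₁)
    (hl : IsC11 A B C l l₁) (a₀ a₁ a₂ : ℝ) {x : ℝ} (hx : x ∈ Icc A B) :
    HasDerivWithinAt (fun z => a₂ * f z + a₁ * z + a₀ + l z) (a₂ * f₁ x + a₁ + l₁ x)
      (Icc A B) x := by
  have h1 := (hf.deriv x hx).const_mul a₂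
  have h2 := (hasDerivWithinAt_id x (Icc A B)).const_mul a₁
  have h3 := ((h1.add h2).add_const a₀).add (hl.deriv x hx)
  rw [mul_one] at h3
  exact h3

/-- Nearly vanishing to second order at `x` persists, up to constants, at distance `ρ` from `x`. -/
theorem form_near {A B C : ℝ} {f f₁ l l₁ : ℝ → ℝ} (hf : IsConvexArc A B C f f₁)
    (hl : IsC11 A B C l l₁) {Q ρ : ℝ} (hQ : 1 ≤ Q) {a₀ a₁ a₂ x y : ℝ} (ha : |a₂| ≤ Q)
    (hx : x ∈ Icc A B) (hy : y ∈ Icc A B) (hxy : |y - x| ≤ ρ)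
    (h1 : |a₂ * f₁ x + a₁ + l₁ x| ≤ Q * ρ) (h0 : |a₂ * f x + a₁ * x + a₀ + l x| ≤ Q * ρ ^ 2) :
    |a₂ * f₁ y + a₁ + l₁ y| ≤ 3 * C * Q * ρ ∧
      |a₂ * f y + a₁ * y + a₀ + l y| ≤ 4 * C * Q * ρ ^ 2 := by
  have hC := hf.one_le
  have hρ : 0 ≤ ρ := (abs_nonneg _).trans hxy
  have hderiv : ∀ z ∈ Icc A B, |z - x| ≤ ρ → |a₂ * f₁ z + a₁ + l₁ z| ≤ 3 * C * Q * ρ := by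
    intro z hz hzx
    have e1 : |a₂ * (f₁ z - f₁ x)| ≤ Q * (C * ρ) := by
      rw [abs_mul]
      have := (hf.lip z hz x hx).trans (mul_le_mul_of_nonneg_left hzx (by linarith))
      gcongr
    have e2 : |l₁ z - l₁ x| ≤ C * ρ :=
      (hl.lip z hz x hx).trans (mul_le_mul_of_nonneg_left hzx (by linarith))
    have e3 : a₂ * f₁ z + a₁ + l₁ z
        = (a₂ * f₁ x + a₁ + l₁ x) + a₂ * (f₁ z - f₁ x) + (l₁ z - l₁ x) := by ring
    rw [e3]
    refine (abs_add_three _ _ _).trans ?_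
    have e4 : C * ρ ≤ Q * (C * ρ) := le_mul_of_one_le_left (by positivity) hQ
    have e5 : Q * ρ ≤ C * (Q * ρ) := le_mul_of_one_le_left (by positivity) hC
    linarith
  refine ⟨hderiv y hy hxy, ?_⟩
  have hsub : uIcc x y ⊆ Icc A B := by
    rw [← uIcc_of_le (hx.1.trans hx.2)]
    exact uIcc_subset_uIcc (by rwa [uIcc_of_le (hx.1.trans hx.2)])
      (by rwa [uIcc_of_le (hx.1.trans hx.2)])
  have hmv := (convex_uIcc x y).norm_image_sub_le_of_norm_hasDerivWithin_le (𝕜 := ℝ)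
    (f := fun z => a₂ * f z + a₁ * z + a₀ + l z) (C := 3 * C * Q * ρ)
    (fun z hz => (form_hasDeriv hf.toIsC11 hl a₀ a₁ a₂ (hsub hz)).mono hsub)
    (fun z hz => hderiv z (hsub hz) ((abs_sub_left_of_mem_uIcc hz).trans hxy))
    left_mem_uIcc right_mem_uIcc
  simp only [Real.norm_eq_abs] at hmv
  have e1 : 3 * C * Q * ρ * |y - x| ≤ 3 * C * Q * ρ * ρ := by gcongr
  have e2 : Q * ρ ^ 2 ≤ C * (Q * ρ ^ 2) := le_mul_of_one_le_left (by positivity) hC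
  have e3 := abs_sub_abs_le_abs_sub (a₂ * f y + a₁ * y + a₀ + l y)
    (a₂ * f x + a₁ * x + a₀ + l x)
  nlinarith

/-! ### Counting the cells that contain many pairs -/

/-- For every denominator `g₂ ≤ P` there are `O(C g₂)` numerators `g₁`. -/
theorem sum_div_le {C P : ℝ} (hC : 1 ≤ C) (hP : 0 ≤ P) (G : Finset (ℤ × ℤ))
    (hG : ∀ g ∈ G, 1 ≤ g.2 ∧ (g.2 : ℝ) ≤ P ∧ |(g.1 : ℝ)| ≤ 2 * C * g.2) :
    ∑ g ∈ G, P / (g.2 : ℝ) ≤ 5 * C * P ^ 2 := by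
  classical
  rw [← Finset.sum_fiberwise_of_maps_to (fun g hg => Finset.mem_image_of_mem Prod.snd hg)]
  have h1 : ∀ b ∈ G.image Prod.snd,
      ∑ g ∈ G with g.2 = b, P / (g.2 : ℝ) ≤ 5 * C * P := by
    intro b hb
    obtain ⟨g₀, hg₀, rfl⟩ := Finset.mem_image.1 hb
    have hb1 : (1 : ℝ) ≤ g₀.2 := by exact_mod_cast (hG g₀ hg₀).1
    have hc : ((G.filter fun g => g.2 = g₀.2).card : ℝ) ≤ 4 * C * g₀.2 / 1 + 1 := by
      refine card_le_of_separated _ (fun g => (g.1 : ℝ)) one_pos (by positivity) ?_ ?_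
      · intro i hi j hj hij
        simp only [Finset.mem_filter] at hi hj
        have hne : i.1 ≠ j.1 := fun h => hij (Prod.ext h (hi.2.trans hj.2.symm))
        have := Int.one_le_abs (sub_ne_zero.2 hne)
        exact_mod_cast this
      · intro i hi j hj
        simp only [Finset.mem_filter] at hi hj
        have e1 := abs_le.1 (hG i hi.1).2.2
        have e2 := abs_le.1 (hG j hj.1).2.2
        rw [hi.2] at e1
        rw [hj.2] at e2
        linarith
    have hc' : ((G.filter fun g => g.2 = g₀.2).card : ℝ) ≤ 5 * C * g₀.2 := by nlinarith
    calc ∑ g ∈ G with g.2 = g₀.2, P / (g.2 : ℝ)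
        = ∑ g ∈ G with g.2 = g₀.2, P / (g₀.2 : ℝ) :=
          Finset.sum_congr rfl fun g hg => by rw [(Finset.mem_filter.1 hg).2]
      _ = (G.filter fun g => g.2 = g₀.2).card * (P / (g₀.2 : ℝ)) := by
          rw [Finset.sum_const, nsmul_eq_mul]
      _ ≤ 5 * C * g₀.2 * (P / (g₀.2 : ℝ)) := by gcongr
      _ = 5 * C * P := by field_simp
  have h2 : ((G.image Prod.snd).card : ℝ) ≤ P := by
    have hsub : G.image Prod.snd ⊆ Finset.Icc 1 ⌊P⌋ := by
      intro b hb
      obtain ⟨g, hg, rfl⟩ := Finset.mem_image.1 hb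
      exact Finset.mem_Icc.2 ⟨(hG g hg).1, Int.le_floor.2 (hG g hg).2.1⟩
    have h3 := Finset.card_le_card hsub
    rw [Int.card_Icc, add_sub_cancel_right] at h3
    have h4 : 0 ≤ ⌊P⌋ := Int.floor_nonneg.2 hP
    calc ((G.image Prod.snd).card : ℝ) ≤ (⌊P⌋.toNat : ℝ) := by exact_mod_cast h3
      _ = ((⌊P⌋.toNat : ℤ) : ℝ) := (Int.cast_natCast _).symm
      _ = (⌊P⌋ : ℝ) := by rw [Int.toNat_of_nonneg h4]
      _ ≤ P := Int.floor_le P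
  calc _ ≤ ∑ _b ∈ G.image Prod.snd, 5 * C * P := Finset.sum_le_sum h1
    _ = (G.image Prod.snd).card * (5 * C * P) := by rw [Finset.sum_const, nsmul_eq_mul]
    _ ≤ P * (5 * C * P) := by gcongr
    _ = 5 * C * P ^ 2 := by ring

theorem card_le_sum_of_fiber_le {α β : Type*} [DecidableEq β] (J : Finset α) (φ : α → β)
    (w : β → ℝ) (h : ∀ c ∈ J.image φ, ((J.filter fun j => φ j = c).card : ℝ) ≤ w c) :
    (J.card : ℝ) ≤ ∑ c ∈ J.image φ, w c := by
  rw [Finset.card_eq_sum_card_image φ J]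
  push_cast
  exact Finset.sum_le_sum h

theorem sum_le_of_level_sets (n M₀ L : ℕ) (K : ℕ → ℕ) (hK : ∀ j < n, K j ≤ L) :
    ∑ j ∈ Finset.range n, K j ≤ n * M₀
      + ∑ M ∈ Finset.Ioc M₀ L, ((Finset.range n).filter fun j => M ≤ K j).card := by
  have h1 : ∀ j ∈ Finset.range n, K j ≤ M₀ + ∑ M ∈ Finset.Ioc M₀ L, if M ≤ K j then 1 else 0 := by
    intro j hj
    have : Finset.Ioc M₀ (K j) ⊆ (Finset.Ioc M₀ L).filter fun M => M ≤ K j := by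
      intro M hM
      simp only [Finset.mem_Ioc, Finset.mem_filter] at *
      exact ⟨⟨hM.1, hM.2.trans (hK j (Finset.mem_range.1 hj))⟩, hM.2⟩
    have := Finset.card_le_card this
    rw [Nat.card_Ioc, Finset.card_filter] at this
    omega
  refine (Finset.sum_le_sum h1).trans ?_
  rw [Finset.sum_add_distrib, Finset.sum_const, Finset.card_range, smul_eq_mul, Finset.sum_comm]
  simp only [Finset.card_filter]
  exact le_rfl

/-- The admissible line directions for cells with at least `M` pairs: `1 ≤ g₂ ≤ 4 Q / M`, and the
homogeneous form of `g` is small together with its derivative at some point. -/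
def IsSmallForm (A B C : ℝ) (f f₁ : ℝ → ℝ) (Q X M : ℝ) (g : ℤ × ℤ) : Prop :=
  1 ≤ g.2 ∧ (g.2 : ℝ) ≤ 4 * Q / M ∧ ∃ y ∈ Icc A B, ∃ g₀ : ℤ,
    |(g.2 : ℝ) * f₁ y + g.1| ≤ 12 * C * X / M ∧
      |(g.2 : ℝ) * f y + g.1 * y + g₀| ≤ 16 * C * X ^ 2 / (Q * M)

/-- Separated points at each of which a small form has a small derivative: each form accounts for
few of the points since its derivative has slope at least `g₂ / C`. -/
theorem card_le_of_small_forms {A B C : ℝ} {f f₁ : ℝ → ℝ} (hf : IsConvexArc A B C f f₁)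
    {Q X M E : ℝ} (hQ : 1 ≤ Q) (hX : 0 < X) (hM : 0 < M) (J : Finset ℕ) (y : ℕ → ℝ)
    (hJy : ∀ j ∈ J, y j ∈ Icc A B) (hysep : ∀ i j : ℕ, i ≠ j → X / Q ≤ |y i - y j|)
    (hline : ∀ j ∈ J, ∃ g : ℤ × ℤ, 1 ≤ g.2 ∧ (g.2 : ℝ) ≤ 4 * Q / M ∧
      |(g.2 : ℝ) * f₁ (y j) + g.1| ≤ 12 * C * X / M ∧
        ∃ g₀ : ℤ, |(g.2 : ℝ) * f (y j) + g.1 * y j + g₀| ≤ 16 * C * X ^ 2 / (Q * M))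
    (hE : ∀ G : Finset (ℤ × ℤ), (∀ g ∈ G, IsSmallForm A B C f f₁ Q X M g) →
      ∑ g ∈ G, 7 * C ^ 2 * (4 * Q / M) / (g.2 : ℝ) ≤ E) : (J.card : ℝ) ≤ E := by
  classical
  have hC := hf.one_le
  have hQ0 : 0 < Q := by linarith
  choose! gl hspec using hline
  refine (card_le_sum_of_fiber_le J gl (fun g => 7 * C ^ 2 * (4 * Q / M) / (g.2 : ℝ)) ?_).trans
    (hE _ ?_)
  · intro c hc
    obtain ⟨j₀, hj₀, rfl⟩ := Finset.mem_image.1 hc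
    obtain ⟨hg1, hg2, -⟩ := hspec j₀ hj₀
    set g := gl j₀
    have hgR : (1 : ℝ) ≤ g.2 := by exact_mod_cast hg1
    have hθ : 0 ≤ 12 * C * X / M := by positivity
    have := card_le_of_separated (J.filter fun j => gl j = g) y (by positivity : 0 < X / Q)
      (L := 2 * (12 * C * X / M) * C / g.2) (by positivity) (fun i _ j _ => hysep i j) ?_
    · refine this.trans ?_
      have e1 : 2 * (12 * C * X / M) * C / g.2 / (X / Q) = 6 * C ^ 2 * (4 * Q / M) / g.2 := by
        field_simp; ring
      have e2 : 1 ≤ (4 * Q / M) / (g.2 : ℝ) := by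
        rw [le_div_iff₀ (by linarith)]; linarith
      have e3 : (4 * Q / M) / (g.2 : ℝ) ≤ C ^ 2 * ((4 * Q / M) / (g.2 : ℝ)) :=
        le_mul_of_one_le_left (by linarith) (one_le_pow₀ hC)
      rw [e1]
      have e4 : 7 * C ^ 2 * (4 * Q / M) / (g.2 : ℝ) = 6 * C ^ 2 * (4 * Q / M) / g.2
        + C ^ 2 * ((4 * Q / M) / (g.2 : ℝ)) := by ring
      linarith
    · intro i hi j hj
      obtain ⟨hi1, hi2⟩ := Finset.mem_filter.1 hi
      obtain ⟨hj1, hj2⟩ := Finset.mem_filter.1 hj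
      rcases le_total (y i) (y j) with h | h
      · have : 0 ≤ 2 * (12 * C * X / M) * C / g.2 := by positivity
        linarith
      · have si := (hspec i hi1).2.2.1
        have sj := (hspec j hj1).2.2.1
        rw [hi2] at si
        rw [hj2] at sj
        have si' := (_root_.abs_le.1 si).2
        have sj' := (_root_.abs_le.1 sj).1
        have hs := hf.le_sub (y j) (hJy j hj1) (y i) (hJy i hi1) h
        rw [le_div_iff₀ (by linarith)]
        have e1 : (f₁ (y i) - f₁ (y j)) * g.2 ≤ 2 * (12 * C * X / M) := by linarith
        calc (y i - y j) * g.2 ≤ C * (f₁ (y i) - f₁ (y j)) * g.2 := by gcongr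
          _ = C * ((f₁ (y i) - f₁ (y j)) * g.2) := by ring
          _ ≤ C * (2 * (12 * C * X / M)) := by gcongr
          _ = _ := by ring
  · intro c hc
    obtain ⟨j, hj, rfl⟩ := Finset.mem_image.1 hc
    obtain ⟨h1, h2, h3, g₀, h4⟩ := hspec j hj
    exact ⟨h1, h2, y j, hJy j hj, g₀, h3, h4⟩

/-- Separated points close to rational points `-g₁ / g₂` of small denominator `g₂`. -/
theorem card_le_of_rational_points {C Q X M : ℝ} (hC : 1 ≤ C) (hQ : 1 ≤ Q) (hX : 0 < X)
    (hCX2 : C * X ^ 2 ≤ 1 / 1000) (hM : 2 ≤ M) (J : Finset ℕ) (y : ℕ → ℝ)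
    (hJy : ∀ j ∈ J, |y j| ≤ C) (hysep : ∀ i j : ℕ, i ≠ j → X / Q ≤ |y i - y j|)
    (hplane : ∀ j ∈ J, ∃ g : ℤ × ℤ, 1 ≤ g.2 ∧ (g.2 : ℝ) ≤ 264 * C * (Q * X) / M ∧
      |(g.2 : ℝ) * y j + g.1| ≤ 352 * C * X ^ 2 / M) :
    (J.card : ℝ) ≤ 20 * C * (264 * C * (Q * X) / M) ^ 2 := by
  classical
  have hQ0 : 0 < Q := by linarith
  have hM0 : 0 < M := by linarith
  set P := 264 * C * (Q * X) / M with hP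
  have hP0 : 0 ≤ P := by positivity
  choose! gp hspec using hplane
  refine (card_le_sum_of_fiber_le J gp (fun g => 4 * (P / (g.2 : ℝ))) ?_).trans ?_
  · intro c hc
    obtain ⟨j₀, hj₀, rfl⟩ := Finset.mem_image.1 hc
    obtain ⟨hg1, hg2, -⟩ := hspec j₀ hj₀
    set g := gp j₀
    have hgR : (1 : ℝ) ≤ g.2 := by exact_mod_cast hg1
    have := card_le_of_separated (J.filter fun j => gp j = g) y (by positivity : 0 < X / Q)
      (L := 2 * (352 * C * X ^ 2 / M) / g.2) (by positivity) (fun i _ j _ => hysep i j) ?_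
    · refine this.trans ?_
      have e1 : 2 * (352 * C * X ^ 2 / M) / g.2 / (X / Q) = (704 / 264) * (P / g.2) := by
        rw [hP]; field_simp; norm_num
      have e2 : 1 ≤ P / (g.2 : ℝ) := by
        rw [le_div_iff₀ (by linarith)]; linarith
      rw [e1]
      linarith
    · intro i hi j hj
      obtain ⟨hi1, hi2⟩ := Finset.mem_filter.1 hi
      obtain ⟨hj1, hj2⟩ := Finset.mem_filter.1 hj
      have si := (hspec i hi1).2.2
      have sj := (hspec j hj1).2.2
      rw [hi2] at si
      rw [hj2] at sj
      have si' := (_root_.abs_le.1 si).2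
      have sj' := (_root_.abs_le.1 sj).1
      rw [le_div_iff₀ (by linarith)]
      linarith
  · rw [← Finset.mul_sum]
    have := sum_div_le hC hP0 (J.image gp) ?_
    · linarith
    · intro c hc
      obtain ⟨j, hj, rfl⟩ := Finset.mem_image.1 hc
      obtain ⟨h1, h2, h3⟩ := hspec j hj
      refine ⟨h1, h2, ?_⟩
      generalize gp j = g at *
      have hgR : (1 : ℝ) ≤ g.2 := by exact_mod_cast h1
      have e1 : |(g.2 : ℝ) * y j| ≤ g.2 * C := by
        rw [abs_mul, abs_of_pos (by linarith)]
        exact mul_le_mul_of_nonneg_left (hJy j hj) (by linarith)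
      have e2 : 352 * C * X ^ 2 / M ≤ 1 := by
        rw [div_le_one hM0]; linarith
      have e3 := abs_sub ((g.2 : ℝ) * y j + g.1) ((g.2 : ℝ) * y j)
      rw [add_sub_cancel_left] at e3
      have e4 : 1 ≤ (g.2 : ℝ) * C := one_le_mul_of_one_le_of_one_le hgR hC
      linarith

/-- Cut `[A, B]` into cells of length `X / Q`.  By `line_or_plane`, the cells with at least `M`
pairs are close to a zero of the derivative of a small homogeneous form, or close to a rational
point of small denominator.  The first contribution is left in terms of the small forms. -/
theorem exists_cells {A B C : ℝ} {f f₁ l l₁ : ℝ → ℝ} (hf : IsConvexArc A B C f f₁)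
    (hl : IsC11 A B C l l₁) (hAB : A ≤ B) {Q X : ℝ} (hQ : 1 ≤ Q) (hX : 0 < X)
    (hXC : 100 * C * X ≤ 1) (T : Finset (ℤ × ℤ))
    (hT : (T : Set (ℤ × ℤ)) ⊆ nearPairs A B f f₁ l l₁ Q (X / Q)) :
    ∃ (n : ℕ) (K : ℕ → ℕ), (n : ℝ) ≤ 4 * C * (Q / X) ∧ T.card = ∑ j ∈ Finset.range n, K j ∧
      (∀ j, (K j : ℝ) ≤ 3 * Q) ∧ ∀ (M : ℕ) (E : ℝ), 2 ≤ M →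
      (∀ G : Finset (ℤ × ℤ), (∀ g ∈ G, IsSmallForm A B C f f₁ Q X M g) →
        ∑ g ∈ G, 7 * C ^ 2 * (4 * Q / M) / (g.2 : ℝ) ≤ E) →
      (((Finset.range n).filter fun j => M ≤ K j).card : ℝ)
        ≤ E + 20 * C * (264 * C * (Q * X) / M) ^ 2 := by
  classical
  have hC := hf.one_le
  have hQ0 : 0 < Q := by linarith
  have hX1 : X ≤ 1 := by nlinarith
  set ρ : ℝ := X / Q with hρ
  have hρ0 : 0 < ρ := by positivity
  have hQρ : Q * ρ = X := by rw [hρ]; field_simp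
  have hch : ∀ a : ℤ × ℤ, ∃ (x : ℝ) (a₀ : ℤ), a ∈ T → x ∈ Icc A B ∧
      |(a.2 : ℝ) * f₁ x + a.1 + l₁ x| ≤ Q * ρ ∧
        |(a.2 : ℝ) * f x + a.1 * x + a₀ + l x| ≤ Q * ρ ^ 2 := by
    intro a
    by_cases ha : a ∈ T
    · obtain ⟨-, x, hx, a₀, h1, h2⟩ := hT ha
      exact ⟨x, a₀, fun _ => ⟨hx, h1, h2⟩⟩
    · exact ⟨0, 0, fun h => absurd h ha⟩
  choose x a₀ hxa using hch
  let cell : ℤ × ℤ → ℕ := fun a => ⌊(x a - A) / ρ⌋₊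
  let y : ℕ → ℝ := fun j => A + j * ρ
  let Tj : ℕ → Finset (ℤ × ℤ) := fun j => T.filter fun a => cell a = j
  set n : ℕ := ⌊(B - A) / ρ⌋₊ + 1 with hn
  have hmaps : Set.MapsTo cell (T : Set (ℤ × ℤ)) (Finset.range n) := by
    intro a ha
    have := (hxa a ha).1
    simp only [cell, Finset.coe_range, Set.mem_Iio, hn, Nat.lt_succ_iff]
    exact Nat.floor_mono (by gcongr; exact this.2)
  -- the left endpoint of a nonempty cell belongs to `[A, B]` and is close to the points chosen
  have hcell : ∀ j, ∀ a ∈ Tj j, y j ∈ Icc A B ∧ |y j - x a| ≤ ρ := by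
    intro j a ha
    obtain ⟨haT, haj⟩ := Finset.mem_filter.1 ha
    have hxm := (hxa a haT).1
    have h0 : 0 ≤ (x a - A) / ρ := div_nonneg (by linarith [hxm.1]) hρ0.le
    have h1 := Nat.floor_le h0
    have h2 := Nat.lt_floor_add_one ((x a - A) / ρ)
    simp only [cell] at haj
    rw [haj, le_div_iff₀ hρ0] at h1
    rw [haj, div_lt_iff₀ hρ0] at h2
    have h3 : 0 ≤ (j : ℝ) * ρ := by positivity
    refine ⟨⟨by simp only [y]; linarith, by simp only [y]; linarith [hxm.2]⟩, ?_⟩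
    rw [abs_le]
    constructor <;> simp only [y] <;> linarith
  have hnear : ∀ j, ∀ a ∈ Tj j,
      |(a.2 : ℝ) * f₁ (y j) + a.1 + l₁ (y j)| ≤ 3 * C * X ∧
        |(a.2 : ℝ) * f (y j) + a.1 * y j + a₀ a + l (y j)| ≤ 4 * C * X ^ 2 / Q := by
    intro j a ha
    have haT := (Finset.mem_filter.1 ha).1
    obtain ⟨hy, hyx⟩ := hcell j a ha
    obtain ⟨h1, h2, h3⟩ := hxa a haT
    have := form_near hf hl hQ (hT haT).1 h1 hy hyx h2 h3
    refine ⟨?_, ?_⟩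
    · calc _ ≤ _ := this.1
        _ = 3 * C * X := by rw [← hQρ]; ring
    · calc _ ≤ _ := this.2
        _ = 4 * C * X ^ 2 / Q := by rw [hρ]; field_simp
  let S : ℕ → Finset (ℤ × (ℤ × ℤ)) := fun j => (Tj j).image fun a => (a₀ a, a)
  have hScard : ∀ j, (S j).card = (Tj j).card := fun j =>
    Finset.card_image_of_injective _ fun a b h => (Prod.mk.inj h).2
  have hbox : ∀ j, ∀ g ∈ S j, ∀ h ∈ S j,
      FormBox (y j) (f (y j)) (f₁ (y j)) (8 * C * X ^ 2 / Q) (6 * C * X) (2 * Q) (g - h) := by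
    intro j g hg h hh
    obtain ⟨a, ha, rfl⟩ := Finset.mem_image.1 hg
    obtain ⟨b, hb, rfl⟩ := Finset.mem_image.1 hh
    have ha1 := hnear j a ha
    have hb1 := hnear j b hb
    have ha2 := (hT (Finset.mem_filter.1 ha).1).1
    have hb2 := (hT (Finset.mem_filter.1 hb).1).1
    refine ⟨?_, ?_, ?_⟩
    · have := (abs_sub _ _).trans (add_le_add ha1.2 hb1.2)
      calc _ = _ := ?_
        _ ≤ _ := this
        _ = _ := by ring
      simp only [Prod.fst_sub, Prod.snd_sub]; push_cast; ring_nf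
    · have := (abs_sub _ _).trans (add_le_add ha1.1 hb1.1)
      calc _ = _ := ?_
        _ ≤ _ := this
        _ = _ := by ring
      simp only [Prod.fst_sub, Prod.snd_sub]; push_cast; ring_nf
    · have := (abs_sub _ _).trans (add_le_add ha2 hb2)
      calc _ = _ := ?_
        _ ≤ _ := this
        _ = _ := by ring
      simp only [Prod.snd_sub]; push_cast; ring_nf
  have hCX : C * X ≤ 1 / 100 := by linarith
  have hCX0 : 0 < C * X := by positivity
  have hCX2 : C * X ^ 2 ≤ 1 / 10000 := by nlinarith
  have hU : 8 * C * X ^ 2 / Q < 1 := by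
    rw [div_lt_one hQ0]; linarith
  have hV : 6 * C * X < 1 := by linarith
  have hUW : 2 * (8 * C * X ^ 2 / Q) * (2 * Q) < 1 := by
    have : 2 * (8 * C * X ^ 2 / Q) * (2 * Q) = 32 * (C * X ^ 2) := by field_simp; ring
    linarith
  have hUVW : 6 * (8 * C * X ^ 2 / Q) * (6 * C * X) * (2 * Q) < 1 := by
    have : 6 * (8 * C * X ^ 2 / Q) * (6 * C * X) * (2 * Q) = 576 * (C * X ^ 2) * (C * X) := by
      field_simp; ring
    rw [this]
    have : (C * X ^ 2) * (C * X) ≤ 1 / 10000 * (1 / 100) := by gcongr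
    linarith
  refine ⟨n, fun j => (Tj j).card, ?_, Finset.card_eq_sum_card_fiberwise hmaps, ?_, ?_⟩
  · have hA := _root_.abs_le.1 (hf.abs_le A (left_mem_Icc.2 hAB))
    have hB := _root_.abs_le.1 (hf.abs_le B (right_mem_Icc.2 hAB))
    have h1 : (⌊(B - A) / ρ⌋₊ : ℝ) ≤ (B - A) / ρ :=
      Nat.floor_le (div_nonneg (by linarith) hρ0.le)
    have h2 : (B - A) / ρ ≤ 2 * C / ρ := by gcongr; linarith
    have h3 : 2 * C / ρ = 2 * C * (Q / X) := by rw [hρ]; field_simp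
    have h4 : 1 ≤ Q / X := by rw [le_div_iff₀ hX]; linarith
    have h5 : 1 ≤ C * (Q / X) := one_le_mul_of_one_le_of_one_le hC h4
    rw [hn]; push_cast; linarith
  · intro j
    simp only
    rw [← hScard]
    have := card_le_of_separated (S j) (fun g => (g.2.2 : ℝ)) one_pos
      (by linarith : (0 : ℝ) ≤ 2 * Q) ?_ ?_
    · linarith
    · intro g hg h hh hgh
      have hne : g.2.2 ≠ h.2.2 := fun h0 =>
        hgh (sub_eq_zero.1 ((hbox j g hg h hh).eq_zero hU hV (by simp [h0])))
      have := Int.one_le_abs (sub_ne_zero.2 hne)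
      exact_mod_cast this
    · intro g hg h hh
      have := (le_abs_self _).trans (hbox j g hg h hh).2.2
      simpa using this
  intro M E hM hE
  simp only
  have hM0 : (0 : ℝ) < M := by exact_mod_cast (by omega : 0 < M)
  have hM2 : (2 : ℝ) ≤ M := by exact_mod_cast hM
  set J := (Finset.range n).filter fun j => M ≤ (Tj j).card with hJ
  have hJy : ∀ j ∈ J, y j ∈ Icc A B := by
    intro j hj
    have hj' := (Finset.mem_filter.1 hj).2
    obtain ⟨a, ha⟩ := Finset.card_pos.1 (by omega : 0 < (Tj j).card)
    exact (hcell j a ha).1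
  have hysep : ∀ i j : ℕ, i ≠ j → ρ ≤ |y i - y j| := by
    intro i j hij
    have h1 : (1 : ℝ) ≤ |(i : ℝ) - j| := by
      have := Int.one_le_abs (sub_ne_zero.2 (Nat.cast_injective.ne hij : (i : ℤ) ≠ j))
      exact_mod_cast this
    have h2 : y i - y j = (i - j) * ρ := by simp only [y]; ring
    rw [h2, abs_mul, abs_of_pos hρ0]
    nlinarith
  let line : ℕ → ℤ × ℤ → Prop := fun j g => 1 ≤ g.2 ∧ (g.2 : ℝ) ≤ 4 * Q / M ∧
    |(g.2 : ℝ) * f₁ (y j) + g.1| ≤ 12 * C * X / M ∧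
      ∃ g₀ : ℤ, |(g.2 : ℝ) * f (y j) + g.1 * y j + g₀| ≤ 16 * C * X ^ 2 / (Q * M)
  let plane : ℕ → ℤ × ℤ → Prop := fun j g => 1 ≤ g.2 ∧ (g.2 : ℝ) ≤ 264 * C * (Q * X) / M ∧
    |(g.2 : ℝ) * y j + g.1| ≤ 352 * C * X ^ 2 / M
  have hdich : ∀ j ∈ J, (∃ g, line j g) ∨ ∃ g, plane j g := by
    intro j hj
    have hj' : M ≤ (S j).card := by rw [hScard]; exact (Finset.mem_filter.1 hj).2
    have hjR : (M : ℝ) ≤ (S j).card := by exact_mod_cast hj'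
    have hk : (M : ℝ) / 2 ≤ (S j).card - 1 := by linarith
    rcases line_or_plane (S j) (by omega) (hbox j) hU hV hUW hUVW with
      ⟨g, h1, h2, h3, h4⟩ | ⟨q, r, h1, h2, h3⟩
    · left
      have aux : ∀ t E : ℝ, 0 ≤ t → ((S j).card - 1 : ℝ) * t ≤ E → t ≤ 2 * E / M := by
        intro t E ht h
        rw [le_div_iff₀ hM0]
        nlinarith [mul_le_mul_of_nonneg_right hk ht]
      refine ⟨g.2, h1, ?_, ?_, g.1, ?_⟩
      · have := aux _ _ (by exact_mod_cast h1.le) h4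
        calc _ ≤ _ := this
          _ = _ := by ring
      · have := aux _ _ (abs_nonneg _) h3
        calc _ ≤ _ := this
          _ = _ := by ring
      · have := aux _ _ (abs_nonneg _) h2
        calc _ ≤ _ := this
          _ = _ := by field_simp; ring
    · right
      have aux : ∀ t E : ℝ, 0 ≤ t → ((S j).card : ℝ) * t ≤ E → t ≤ E / M := by
        intro t E ht h
        rw [le_div_iff₀ hM0]
        nlinarith [mul_le_mul_of_nonneg_right hjR ht]
      refine ⟨(r, q), h1, ?_, ?_⟩
      · have := aux _ _ (by exact_mod_cast h1.le) h2
        calc _ ≤ _ := this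
          _ = _ := by ring
      · have := aux _ _ (abs_nonneg _) h3
        calc _ ≤ _ := this
          _ = _ := by field_simp; ring
  set J1 := J.filter fun j => ∃ g, line j g with hJ1
  set J2 := J.filter fun j => ∃ g, plane j g with hJ2
  have hJ12 : J ⊆ J1 ∪ J2 := by
    intro j hj
    rcases hdich j hj with h | h
    · exact Finset.mem_union_left _ (Finset.mem_filter.2 ⟨hj, h⟩)
    · exact Finset.mem_union_right _ (Finset.mem_filter.2 ⟨hj, h⟩)
  have hcard : (J.card : ℝ) ≤ J1.card + J2.card := by
    exact_mod_cast (Finset.card_le_card hJ12).trans (Finset.card_union_le _ _)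
  have hc1 : (J1.card : ℝ) ≤ E :=
    card_le_of_small_forms hf hQ hX hM0 J1 y
      (fun j hj => hJy j (Finset.mem_filter.1 hj).1) hysep
      (fun j hj => (Finset.mem_filter.1 hj).2) hE
  have hc2 : (J2.card : ℝ) ≤ 20 * C * (264 * C * (Q * X) / M) ^ 2 :=
    card_le_of_rational_points hC hQ hX (by linarith) hM2 J2 y
      (fun j hj => hf.abs_le _ (hJy j (Finset.mem_filter.1 hj).1)) hysep
      (fun j hj => (Finset.mem_filter.1 hj).2)
  linarith

/-! ### Counting the near pairs -/

/-- A layer-cake estimate: values up to `M₀` are counted trivially, larger ones through their level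
sets. -/
theorem sum_le_of_level_bound {n M₀ L : ℕ} (hM₀ : M₀ ≠ 0) (K : ℕ → ℕ) (hK : ∀ j < n, K j ≤ L)
    {D E : ℝ} (hD : 0 ≤ D) (hE : 0 ≤ E)
    (h : ∀ M, M₀ < M → (((Finset.range n).filter fun j => M ≤ K j).card : ℝ)
      ≤ D * ((M : ℝ) ^ 2)⁻¹ + E) :
    ((∑ j ∈ Finset.range n, K j : ℕ) : ℝ) ≤ n * M₀ + D / M₀ + L * E := by
  have h1 : ((∑ j ∈ Finset.range n, K j : ℕ) : ℝ) ≤ n * M₀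
      + ∑ M ∈ Finset.Ioc M₀ L, (((Finset.range n).filter fun j => M ≤ K j).card : ℝ) := by
    exact_mod_cast sum_le_of_level_sets n M₀ L K hK
  have h2 : ∑ M ∈ Finset.Ioc M₀ L, (((Finset.range n).filter fun j => M ≤ K j).card : ℝ)
      ≤ ∑ M ∈ Finset.Ioc M₀ L, (D * ((M : ℝ) ^ 2)⁻¹ + E) :=
    Finset.sum_le_sum fun M hM => h M (Finset.mem_Ioc.1 hM).1
  have h3 : ∑ M ∈ Finset.Ioc M₀ L, ((M : ℝ) ^ 2)⁻¹ ≤ (M₀ : ℝ)⁻¹ := by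
    rcases le_total M₀ L with hL | hL
    · have := sum_Ioc_inv_sq_le_sub (α := ℝ) hM₀ hL
      have : (0 : ℝ) ≤ (L : ℝ)⁻¹ := by positivity
      linarith
    · rw [Finset.Ioc_eq_empty (by omega), Finset.sum_empty]; positivity
  rw [Finset.sum_add_distrib, ← Finset.mul_sum, Finset.sum_const, Nat.card_Ioc, nsmul_eq_mul] at h2
  have h4 : ((L - M₀ : ℕ) : ℝ) * E ≤ L * E := by
    gcongr; exact Nat.sub_le _ _
  have h5 := mul_le_mul_of_nonneg_left h3 hD
  rw [div_eq_mul_inv]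
  linarith

theorem IsSmallForm.abs_fst_le {A B C : ℝ} {f f₁ : ℝ → ℝ} (hf : IsConvexArc A B C f f₁)
    {Q X M : ℝ} (hXC : 100 * C * X ≤ 1) (hM : 1 ≤ M) {g : ℤ × ℤ}
    (hg : IsSmallForm A B C f f₁ Q X M g) : |(g.1 : ℝ)| ≤ 2 * C * g.2 := by
  obtain ⟨h1, -, y, hy, -, h2, -⟩ := hg
  have hC := hf.one_le
  have hgR : (1 : ℝ) ≤ g.2 := by exact_mod_cast h1
  have e1 : |(g.2 : ℝ) * f₁ y| ≤ g.2 * C := by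
    rw [abs_mul, abs_of_pos (by linarith)]
    exact mul_le_mul_of_nonneg_left (hf.bound_deriv y hy) (by linarith)
  have e2 : 12 * C * X / M ≤ 1 := by
    rw [div_le_one (by linarith)]; linarith
  have e3 := abs_sub ((g.2 : ℝ) * f₁ y + g.1) ((g.2 : ℝ) * f₁ y)
  rw [add_sub_cancel_left] at e3
  have e4 : 1 ≤ (g.2 : ℝ) * C := one_le_mul_of_one_le_of_one_le hgR hC
  linarith

/-- The first count: `O(Q^{3/2})` near pairs, `Q = w²`, at the largest admissible cell length.  All
small forms are counted as possible line directions. -/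
theorem card_nearPairs_le {A B C : ℝ} {f f₁ l l₁ : ℝ → ℝ} (hf : IsConvexArc A B C f f₁)
    (hl : IsC11 A B C l l₁) (hAB : A ≤ B) {w : ℝ} (hw : 1 ≤ w) (T : Finset (ℤ × ℤ))
    (hT : (T : Set (ℤ × ℤ)) ⊆ nearPairs A B f f₁ l l₁ (w ^ 2) (1 / (100 * C) / w ^ 2)) :
    (T.card : ℝ) ≤ 1500 * C ^ 3 * w ^ 3 := by
  have hC := hf.one_le
  have hC0 : 0 < C := by linarith
  have hw0 : 0 < w := by linarith
  obtain ⟨n, K, hn, hTK, hK, hlev⟩ := exists_cells hf hl hAB (one_le_pow₀ hw : 1 ≤ w ^ 2)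
    (by positivity : 0 < 1 / (100 * C)) (by field_simp; exact le_rfl) T hT
  have hM₀ : w ≤ (⌈w⌉₊ : ℝ) := Nat.le_ceil w
  have hM₀' : (⌈w⌉₊ : ℝ) ≤ 2 * w := by linarith [(Nat.ceil_lt_add_one hw0.le).le]
  have hM1 : 1 ≤ ⌈w⌉₊ := Nat.one_le_iff_ne_zero.2 (by positivity)
  rw [hTK]
  refine (sum_le_of_level_bound (M₀ := ⌈w⌉₊) (L := ⌊3 * w ^ 2⌋₊) (by omega) K
    (fun j _ => Nat.le_floor (hK j)) (D := 700 * C ^ 3 * w ^ 4) (E := 0) (by positivity) le_rfl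
    ?_).trans ?_
  · intro M hM
    have hMR : (1 : ℝ) ≤ M := by exact_mod_cast (by omega : 1 ≤ M)
    refine (hlev M (7 * C ^ 2 * (5 * C * (4 * w ^ 2 / M) ^ 2)) (by omega) ?_).trans ?_
    · intro G hG
      simp_rw [mul_div_assoc (7 * C ^ 2)]
      rw [← Finset.mul_sum]
      gcongr
      exact sum_div_le hC (by positivity) G fun g hg => ⟨(hG g hg).1, (hG g hg).2.1,
        (hG g hg).abs_fst_le hf (by field_simp; exact le_rfl) hMR⟩
    · have e1 : 7 * C ^ 2 * (5 * C * (4 * w ^ 2 / M) ^ 2)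
            = 560 * C ^ 3 * (w ^ 4 * ((M : ℝ) ^ 2)⁻¹) := by
        field_simp; ring
      have e2 : 20 * C * (264 * C * (w ^ 2 * (1 / (100 * C))) / M) ^ 2
          = (20 * 2.64 ^ 2) * C * (w ^ 4 * ((M : ℝ) ^ 2)⁻¹) := by
        field_simp; norm_num
      have e3 : C ≤ C ^ 3 := le_self_pow₀ hC (by norm_num)
      have e4 : (20 * 2.64 ^ 2) * C * (w ^ 4 * ((M : ℝ) ^ 2)⁻¹)
          ≤ 140 * C ^ 3 * (w ^ 4 * ((M : ℝ) ^ 2)⁻¹) := by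
        gcongr; norm_num
      rw [e1, e2]
      linarith
  · have e1 : (n : ℝ) * ⌈w⌉₊ ≤ 4 * C * (w ^ 2 / (1 / (100 * C))) * (2 * w) := by gcongr
    have e2 : 4 * C * (w ^ 2 / (1 / (100 * C))) * (2 * w) = 800 * C ^ 2 * w ^ 3 := by
      field_simp; norm_num
    have e3 : 700 * C ^ 3 * w ^ 4 / (⌈w⌉₊ : ℝ) ≤ 700 * C ^ 3 * w ^ 4 / w := by gcongr
    have e4 : 700 * C ^ 3 * w ^ 4 / w = 700 * C ^ 3 * w ^ 3 := by field_simp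
    have e5 : 800 * C ^ 2 * w ^ 3 ≤ 800 * C ^ 3 * w ^ 3 := by
      gcongr ?_ * _
      have : C ^ 2 ≤ C ^ 3 := pow_le_pow_right₀ hC (by norm_num)
      linarith
    linarith

theorem isC11_zero {A B C : ℝ} (hC : 0 ≤ C) : IsC11 A B C (fun _ => 0) (fun _ => 0) where
  deriv x _ := hasDerivWithinAt_const x _ _
  bound x _ := by simpa using hC
  bound_deriv x _ := by simpa using hC
  lip x _ y _ := by simpa using mul_nonneg hC (abs_nonneg (x - y))

theorem pow_three_mul_le {v Z : ℝ} (hv : 0 ≤ v) (hZ : 1 ≤ Z) : Z * v ^ 3 ≤ v ^ 4 / Z + Z ^ 7 := by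
  have hZ0 : 0 < Z := by linarith
  rcases le_total (Z ^ 2) v with h | h
  · have : Z * v ^ 3 ≤ v ^ 4 / Z := by
      rw [le_div_iff₀ hZ0]
      calc Z * v ^ 3 * Z = Z ^ 2 * v ^ 3 := by ring
        _ ≤ v * v ^ 3 := by gcongr
        _ = v ^ 4 := by ring
    have : 0 ≤ Z ^ 7 := by positivity
    linarith
  · have : Z * v ^ 3 ≤ Z ^ 7 := by
      calc Z * v ^ 3 ≤ Z * (Z ^ 2) ^ 3 := by gcongr
        _ = Z ^ 7 := by ring
    have : 0 ≤ v ^ 4 / Z := by positivity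
    linarith

/-- The small forms are themselves near pairs for `l = 0`, so the first count applies to those
with large `g₂`; those with `g₂ ≤ R / Z` are counted trivially. -/
theorem sum_smallForm_le {A B C : ℝ} {f f₁ : ℝ → ℝ} (hf : IsConvexArc A B C f f₁) (hAB : A ≤ B)
    {Q X M Z : ℝ} (hQ : 1 ≤ Q) (hX : 0 < X) (hXC : 100 * C * X ≤ 1) (hM : 16 * C ≤ M) (hZ : 1 ≤ Z)
    (G : Finset (ℤ × ℤ)) (hG : ∀ g ∈ G, IsSmallForm A B C f f₁ Q X M g) :
    ∑ g ∈ G, (4 * Q / M) / (g.2 : ℝ)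
      ≤ (5 * C + 1500 * C ^ 3) * (4 * Q / M) ^ 2 / Z + 1500 * C ^ 3 * Z ^ 7 := by
  classical
  have hC := hf.one_le
  have hC0 : 0 < C := by linarith
  have hM0 : 0 < M := by linarith
  have hM1 : 1 ≤ M := by linarith
  have hZ0 : 0 < Z := by linarith
  set R := 4 * Q / M with hR
  have hR0 : 0 < R := by positivity
  rw [← Finset.sum_filter_add_sum_filter_not G (fun g => (g.2 : ℝ) ≤ R / Z)]
  have h1 : ∑ g ∈ G with (g.2 : ℝ) ≤ R / Z, R / (g.2 : ℝ) ≤ 5 * C * R ^ 2 / Z := by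
    have := sum_div_le hC (by positivity : 0 ≤ R / Z) (G.filter fun g => (g.2 : ℝ) ≤ R / Z) ?_
    · calc ∑ g ∈ G with (g.2 : ℝ) ≤ R / Z, R / (g.2 : ℝ)
          = Z * ∑ g ∈ G with (g.2 : ℝ) ≤ R / Z, (R / Z) / (g.2 : ℝ) := by
            rw [Finset.mul_sum]
            refine Finset.sum_congr rfl fun g _ => ?_
            field_simp
        _ ≤ Z * (5 * C * (R / Z) ^ 2) := by gcongr
        _ = _ := by field_simp
    · intro g hg
      obtain ⟨hg1, hg2⟩ := Finset.mem_filter.1 hg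
      exact ⟨(hG g hg1).1, hg2, (hG g hg1).abs_fst_le hf hXC hM1⟩
  have h2 : ∑ g ∈ G with ¬ (g.2 : ℝ) ≤ R / Z, R / (g.2 : ℝ)
      ≤ 1500 * C ^ 3 * (R ^ 2 / Z + Z ^ 7) := by
    rcases (G.filter fun g => ¬ (g.2 : ℝ) ≤ R / Z).eq_empty_or_nonempty with he | ⟨g₁, hg₁⟩
    · rw [he, Finset.sum_empty]; positivity
    have hR1 : 1 ≤ R := by
      obtain ⟨a, b, -⟩ := hG g₁ (Finset.mem_filter.1 hg₁).1
      have : (1 : ℝ) ≤ g₁.2 := by exact_mod_cast a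
      linarith
    have hcount := card_nearPairs_le hf (isC11_zero hC0.le) hAB (Real.one_le_sqrt.2 hR1)
      (G.filter fun g => ¬ (g.2 : ℝ) ≤ R / Z) ?_
    · calc ∑ g ∈ G with ¬ (g.2 : ℝ) ≤ R / Z, R / (g.2 : ℝ)
          ≤ ∑ g ∈ G with ¬ (g.2 : ℝ) ≤ R / Z, Z := by
            refine Finset.sum_le_sum fun g hg => ?_
            obtain ⟨hg1, hg2⟩ := Finset.mem_filter.1 hg
            have : (1 : ℝ) ≤ g.2 := by exact_mod_cast (hG g hg1).1
            rw [not_le, div_lt_iff₀ hZ0] at hg2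
            rw [div_le_iff₀ (by linarith)]
            linarith
        _ = (G.filter fun g => ¬ (g.2 : ℝ) ≤ R / Z).card * Z := by
            rw [Finset.sum_const, nsmul_eq_mul]
        _ ≤ 1500 * C ^ 3 * √R ^ 3 * Z := by gcongr
        _ = 1500 * C ^ 3 * (Z * √R ^ 3) := by ring
        _ ≤ 1500 * C ^ 3 * (√R ^ 4 / Z + Z ^ 7) := by
            gcongr; exact pow_three_mul_le (Real.sqrt_nonneg _) hZ
        _ = 1500 * C ^ 3 * (R ^ 2 / Z + Z ^ 7) := by
            have : √R ^ 4 = (√R ^ 2) ^ 2 := by ring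
            rw [this, Real.sq_sqrt hR0.le]
    · intro g hg
      rw [Real.sq_sqrt hR0.le]
      have hg1 := (Finset.mem_filter.1 (Finset.mem_coe.1 hg)).1
      obtain ⟨a1, a2, y, hy, g₀, a3, a4⟩ := hG g hg1
      have hgR : (1 : ℝ) ≤ g.2 := by exact_mod_cast a1
      have hXκ : X ≤ 1 / (100 * C) := by
        rw [le_div_iff₀ (by positivity)]; linarith
      refine ⟨by rwa [abs_of_pos (by linarith)], y, hy, g₀, ?_, ?_⟩
      · rw [add_zero]
        refine a3.trans ?_
        have : R * (1 / (100 * C) / R) = 1 / (100 * C) := by field_simp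
        rw [this, div_le_iff₀ hM0]
        calc 12 * C * X ≤ M * X := by gcongr; linarith
          _ ≤ M * (1 / (100 * C)) := by gcongr
          _ = _ := by ring
      · rw [add_zero]
        refine a4.trans ?_
        have : R * (1 / (100 * C) / R) ^ 2 = (1 / (100 * C)) ^ 2 * M / (4 * Q) := by
          rw [hR]; field_simp
        rw [this, div_le_div_iff₀ (by positivity) (by positivity)]
        have h3 : 64 * C ≤ M * M := by nlinarith
        calc 16 * C * X ^ 2 * (4 * Q) = 64 * C * X ^ 2 * Q := by ring
          _ ≤ M * M * (1 / (100 * C)) ^ 2 * Q := by gcongr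
          _ = _ := by ring
  calc _ ≤ 5 * C * R ^ 2 / Z + 1500 * C ^ 3 * (R ^ 2 / Z + Z ^ 7) := add_le_add h1 h2
    _ = _ := by ring

/-- The second count: for cells shorter by the factor `t²`, the number of near pairs is
`O(Q^{3/2} / t)`, `Q = w²`, provided that `t` is at most a small power of `Q`. -/
theorem card_nearPairs_le_div {A B C : ℝ} {f f₁ l l₁ : ℝ → ℝ} (hf : IsConvexArc A B C f f₁)
    (hl : IsC11 A B C l l₁) (hAB : A ≤ B) {w t : ℝ} (hw : 1 ≤ w) (ht : 1 ≤ t) (htw : t ^ 29 ≤ w)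
    (T : Finset (ℤ × ℤ))
    (hT : (T : Set (ℤ × ℤ)) ⊆ nearPairs A B f f₁ l l₁ (w ^ 2) (1 / (100 * C) / t ^ 2 / w ^ 2)) :
    (T.card : ℝ) ≤ 400000 * C ^ 5 * (w ^ 3 / t) := by
  have hC := hf.one_le
  have hC0 : 0 < C := by linarith
  have hw0 : 0 < w := by linarith
  have ht0 : 0 < t := by linarith
  set X := 1 / (100 * C) / t ^ 2 with hX
  have hX0 : 0 < X := by positivity
  have hCX : C * X = 1 / 100 / t ^ 2 := by rw [hX]; field_simp
  have hXC : 100 * C * X ≤ 1 := by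
    rw [mul_assoc, hCX]
    have : 1 / 100 / t ^ 2 ≤ 1 / 100 := div_le_self (by norm_num) (one_le_pow₀ ht)
    linarith
  obtain ⟨n, K, hn, hTK, hK, hlev⟩ := exists_cells hf hl hAB (one_le_pow₀ hw : 1 ≤ w ^ 2)
    hX0 hXC T hT
  set m : ℝ := 16 * C * (w / t ^ 3) with hm
  have hwt : 1 ≤ w / t ^ 3 := by
    rw [le_div_iff₀ (by positivity), one_mul]
    exact (pow_le_pow_right₀ ht (by norm_num)).trans htw
  have hCwt : 1 ≤ C * (w / t ^ 3) := one_le_mul_of_one_le_of_one_le hC hwt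
  have hmC : 16 * C ≤ m := le_mul_of_one_le_right (by positivity) hwt
  have hM₀ : m ≤ (⌈m⌉₊ : ℝ) := Nat.le_ceil m
  have hM₀' : (⌈m⌉₊ : ℝ) ≤ 17 * C * (w / t ^ 3) := by
    linarith [(Nat.ceil_lt_add_one (by linarith : 0 ≤ m)).le]
  have hM1 : 1 ≤ ⌈m⌉₊ := Nat.one_le_iff_ne_zero.2 (by positivity)
  rw [hTK]
  refine (sum_le_of_level_bound (M₀ := ⌈m⌉₊) (L := ⌊3 * w ^ 2⌋₊) (by omega) K
    (fun j _ => Nat.le_floor (hK j))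
    (D := (112 * C ^ 2 * (5 * C + 1500 * C ^ 3) + 140 * C) * (w ^ 4 / t ^ 4))
    (E := 7 * C ^ 2 * (1500 * C ^ 3 * t ^ 28)) (by positivity) (by positivity) ?_).trans ?_
  · intro M hM
    have hmM : m ≤ (M : ℝ) := hM₀.trans (by exact_mod_cast hM.le)
    have hM0 : (0 : ℝ) < M := by linarith
    refine (hlev M (7 * C ^ 2 * ((5 * C + 1500 * C ^ 3) * (4 * w ^ 2 / M) ^ 2 / t ^ 4
      + 1500 * C ^ 3 * (t ^ 4) ^ 7)) (by omega) ?_).trans ?_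
    · intro G hG
      simp_rw [mul_div_assoc (7 * C ^ 2)]
      rw [← Finset.mul_sum]
      gcongr
      exact sum_smallForm_le hf hAB (one_le_pow₀ hw) hX0 hXC (hmC.trans hmM) (one_le_pow₀ ht) G hG
    · have e2 : 20 * C * (264 * C * (w ^ 2 * X) / M) ^ 2
          = (20 * 2.64 ^ 2) * C * (w ^ 4 / t ^ 4 * ((M : ℝ) ^ 2)⁻¹) := by
        have : 264 * C * (w ^ 2 * X) / M = 264 * (C * X) * w ^ 2 / M := by ring
        rw [this, hCX]; field_simp; norm_num
      have e4 : (20 * 2.64 ^ 2) * C * (w ^ 4 / t ^ 4 * ((M : ℝ) ^ 2)⁻¹)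
          ≤ 140 * C * (w ^ 4 / t ^ 4 * ((M : ℝ) ^ 2)⁻¹) := by
        gcongr; norm_num
      have e1 : 7 * C ^ 2 * ((5 * C + 1500 * C ^ 3) * (4 * w ^ 2 / M) ^ 2 / t ^ 4
          + 1500 * C ^ 3 * (t ^ 4) ^ 7)
          = 112 * C ^ 2 * (5 * C + 1500 * C ^ 3) * (w ^ 4 / t ^ 4 * ((M : ℝ) ^ 2)⁻¹)
            + 7 * C ^ 2 * (1500 * C ^ 3 * t ^ 28) := by
        field_simp; ring
      rw [e1, e2]
      linarith
  · have e1 : (n : ℝ) * ⌈m⌉₊ ≤ 4 * C * (w ^ 2 / X) * (17 * C * (w / t ^ 3)) := by gcongr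
    have e2 : 4 * C * (w ^ 2 / X) * (17 * C * (w / t ^ 3)) = 6800 * C ^ 3 * (w ^ 3 / t) := by
      rw [hX]; field_simp; norm_num
    have e3 : (112 * C ^ 2 * (5 * C + 1500 * C ^ 3) + 140 * C) * (w ^ 4 / t ^ 4) / (⌈m⌉₊ : ℝ)
        ≤ (112 * C ^ 2 * (5 * C + 1500 * C ^ 3) + 140 * C) * (w ^ 4 / t ^ 4) / (w / t ^ 3) := by
      gcongr
      refine le_trans ?_ hM₀
      rw [hm]
      nlinarith
    have e4 : (112 * C ^ 2 * (5 * C + 1500 * C ^ 3) + 140 * C) * (w ^ 4 / t ^ 4) / (w / t ^ 3)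
        = (112 * C ^ 2 * (5 * C + 1500 * C ^ 3) + 140 * C) * (w ^ 3 / t) := by
      field_simp
    have e5 : (⌊3 * w ^ 2⌋₊ : ℝ) * (7 * C ^ 2 * (1500 * C ^ 3 * t ^ 28))
        ≤ 3 * w ^ 2 * (7 * C ^ 2 * (1500 * C ^ 3 * t ^ 28)) := by
      gcongr; exact Nat.floor_le (by positivity)
    have e6 : t ^ 28 ≤ w / t := by
      rw [le_div_iff₀ ht0]; calc t ^ 28 * t = t ^ 29 := by ring
        _ ≤ w := htw
    have e7 : 3 * w ^ 2 * (7 * C ^ 2 * (1500 * C ^ 3 * t ^ 28))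
        ≤ 3 * w ^ 2 * (7 * C ^ 2 * (1500 * C ^ 3 * (w / t))) := by gcongr
    have e8 : 3 * w ^ 2 * (7 * C ^ 2 * (1500 * C ^ 3 * (w / t))) = 31500 * C ^ 5 * (w ^ 3 / t) := by
      ring
    have p3 : C ^ 3 ≤ C ^ 5 := pow_le_pow_right₀ hC (by norm_num)
    have p1 : C ≤ C ^ 5 := le_self_pow₀ hC (by norm_num)
    have p5 : 6800 * C ^ 3 + (112 * C ^ 2 * (5 * C + 1500 * C ^ 3) + 140 * C) + 31500 * C ^ 5
        ≤ 400000 * C ^ 5 := by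
      have : 112 * C ^ 2 * (5 * C + 1500 * C ^ 3) = 560 * C ^ 3 + 168000 * C ^ 5 := by ring
      have : 0 ≤ C ^ 5 := by positivity
      linarith
    have hwt0 : 0 ≤ w ^ 3 / t := by positivity
    have := mul_le_mul_of_nonneg_right p5 hwt0
    linarith

/-! ### Hausdorff measure of limsup sets -/

open scoped ENNReal in
/-- The Borel–Cantelli lemma for Hausdorff measures. -/
theorem hausdorffMeasure_limsup_eq_zero {ι : Type*} [Countable ι] {s : ℝ} (hs : 0 < s)
    (E : ι → Set ℝ) (hE : ∑' i, Metric.ediam (E i) ^ s ≠ ∞) :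
    μH[s] {x | {i | x ∈ E i}.Infinite} = 0 := by
  classical
  set g : ι → ℝ≥0∞ := fun i => Metric.ediam (E i) ^ s with hg
  set tail : Finset ι → ℝ≥0∞ := fun F => ∑' i : {i // i ∉ F}, g i with htail
  have htail0 : Tendsto tail atTop (𝓝 0) := ENNReal.tendsto_tsum_compl_atTop_zero hE
  have hr : Tendsto (fun F => tail F ^ (1 / s)) atTop (𝓝 0) := by
    have := htail0.ennrpow_const (1 / s)
    rwa [ENNReal.zero_rpow_of_pos (by positivity)] at this
  have hle := Measure.hausdorffMeasure_le_liminf_tsum (ι := fun F : Finset ι => {i // i ∉ F}) s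
    {x | {i | x ∈ E i}.Infinite} (fun F => tail F ^ (1 / s)) hr (fun F i => E i)
    (Eventually.of_forall fun F i => by
      have h1 : Metric.ediam (E i) ^ s ≤ tail F :=
        ENNReal.le_tsum (f := fun i : {i // i ∉ F} => g i) i
      calc Metric.ediam (E i) = (Metric.ediam (E i) ^ s) ^ (1 / s) := by
            rw [← ENNReal.rpow_mul, mul_one_div_cancel hs.ne', ENNReal.rpow_one]
        _ ≤ tail F ^ (1 / s) := ENNReal.rpow_le_rpow h1 (by positivity))
    (Eventually.of_forall fun F x hx => by
      obtain ⟨i, hi, hiF⟩ := Set.Infinite.exists_notMem_finset hx F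
      exact mem_iUnion.2 ⟨⟨i, hiF⟩, hi⟩)
  rw [htail0.liminf_eq] at hle
  exact le_antisymm hle bot_le

theorem ediam_rpow_le {s d : ℝ} (hs : 0 < s) {E : Set ℝ}
    (h : ∀ x ∈ E, ∀ y ∈ E, |x - y| ≤ d) (hd : 0 ≤ d) :
    Metric.ediam E ^ s ≤ ENNReal.ofReal (d ^ s) := by
  rw [← ENNReal.ofReal_rpow_of_nonneg hd hs.le]
  refine ENNReal.rpow_le_rpow (Metric.ediam_le fun x hx y hy => ?_) hs.le
  rw [edist_dist, Real.dist_eq]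
  exact ENNReal.ofReal_le_ofReal (h x hx y hy)

/-! ### Sublevel sets of functions with an increasing derivative -/

/-- Sublevel sets to the right of a point `z` from which the derivative `F₁` increases with slope
`b`, having size at least `μ` at `z`. -/
theorem sublevel_right {z B b μ c ψ : ℝ} {F F₁ : ℝ → ℝ} (hb : 0 < b) (hμ : 0 ≤ μ)
    (hF : ∀ x ∈ Icc z B, HasDerivWithinAt F (F₁ x) (Icc z B) x)
    (hmono : ∀ x ∈ Icc z B, ∀ y ∈ Icc z B, x ≤ y → F₁ x ≤ F₁ y)
    (hgrow : ∀ x ∈ Icc z B, z < x → μ + b * (x - z) ≤ F₁ x) {x y : ℝ} (hx : x ∈ Icc z B)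
    (hy : y ∈ Icc z B) (hxy : x ≤ y) (hxψ : |F x + c| < ψ) (hyψ : |F y + c| < ψ) :
    μ * (y - x) ≤ 2 * ψ ∧ b * (y - x) ^ 2 ≤ 4 * ψ ∧
      (2 * ψ ≤ |F z + c| → b * |F z + c| * (y - x) ^ 2 ≤ 8 * ψ ^ 2) := by
  have hcont : ContinuousOn F (Icc z B) := fun x hx => (hF x hx).continuousWithinAt
  -- comparison with a polynomial of degree at most two
  have hcomp : ∀ (p r : ℝ) (u v : ℝ), u ∈ Icc z B → v ∈ Icc z B → u ≤ v →
      (∀ t ∈ Ioo u v, p + r * (t - z) ≤ F₁ t) →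
      p * (v - u) + r * ((v - z) ^ 2 - (u - z) ^ 2) / 2 ≤ F v - F u := by
    intro p r u v hu hv huv hle
    have hsub : Icc u v ⊆ Icc z B := Icc_subset_Icc hu.1 hv.2
    have hmon : MonotoneOn (fun t => F t - (p * t + r * (t - z) ^ 2 / 2)) (Icc u v) := by
      refine monotoneOn_of_hasDerivWithinAt_nonneg (f' := fun t => F₁ t - (p + r * (t - z)))
        (convex_Icc u v) ?_ ?_ ?_
      · exact (hcont.mono hsub).sub (by fun_prop)
      · intro t ht
        rw [interior_Icc] at ht ⊢
        have hsub' : Ioo u v ⊆ Icc z B := Ioo_subset_Icc_self.trans hsub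
        have h1 := (hF t (hsub' ht)).mono hsub'
        have h2 : HasDerivAt (fun t => p * t + r * (t - z) ^ 2 / 2) (p + r * (t - z)) t := by
          have := ((hasDerivAt_id t).const_mul p).add
            (((((hasDerivAt_id t).sub_const z).pow 2).const_mul r).div_const 2)
          refine this.congr_deriv ?_
          simp; ring
        exact h1.sub h2.hasDerivWithinAt
      · intro t ht
        rw [interior_Icc] at ht
        linarith [hle t ht]
    have := hmon (left_mem_Icc.2 huv) (right_mem_Icc.2 huv) huv
    simp only at this
    linarith
  have hxψ' := abs_lt.1 hxψ
  have hyψ' := abs_lt.1 hyψ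
  have hd : F y - F x ≤ 2 * ψ := by linarith
  have hψ : 0 < ψ := (abs_nonneg _).trans_lt hxψ
  have h1 := hcomp μ b x y hx hy hxy fun t ht =>
    hgrow t ⟨hx.1.trans ht.1.le, ht.2.le.trans hy.2⟩ (hx.1.trans_lt ht.1)
  have hyx : 0 ≤ y - x := by linarith
  have hxz : 0 ≤ x - z := by linarith [hx.1]
  have hsq : (y - x) ^ 2 ≤ (y - z) ^ 2 - (x - z) ^ 2 := by nlinarith
  have hsq' := mul_le_mul_of_nonneg_left hsq hb.le
  have hμ' : 0 ≤ μ * (y - x) := by positivity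
  have hb' : 0 ≤ b * (y - x) ^ 2 := by positivity
  refine ⟨by linarith, by linarith, fun hm => ?_⟩
  have hzB : z ∈ Icc z B := left_mem_Icc.2 (hx.1.trans hx.2)
  rcases hx.1.eq_or_lt with rfl | hzx
  · linarith
  set p := F₁ x with hp
  have hp0 : b * (x - z) ≤ p := by linarith [hgrow x hx hzx]
  have hxz' : 0 < x - z := by linarith
  have hppos : 0 < p := (mul_pos hb hxz').trans_le hp0
  have h2 := hcomp p 0 x y hx hy hxy fun t ht => by
    have := hmono x hx t ⟨hx.1.trans ht.1.le, ht.2.le.trans hy.2⟩ ht.1.le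
    linarith
  have h3 := hcomp 0 0 z x hzB hx hzx.le fun t ht => by
    have ht' : t ∈ Icc z B := ⟨ht.1.le, ht.2.le.trans hx.2⟩
    have := hgrow t ht' ht.1
    have : 0 ≤ b * (t - z) := mul_nonneg hb.le (by linarith [ht.1])
    linarith
  -- `F` rises by at most `p (x - z)` between `z` and `x`
  have h4 : F x - F z ≤ p * (x - z) := by
    have hsub : Icc z x ⊆ Icc z B := Icc_subset_Icc le_rfl hx.2
    have hmon : MonotoneOn (fun t => p * t - F t) (Icc z x) := by
      refine monotoneOn_of_hasDerivWithinAt_nonneg (f' := fun t => p - F₁ t)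
        (convex_Icc z x) ((by fun_prop : ContinuousOn (fun t => p * t) _).sub (hcont.mono hsub))
        ?_ ?_
      · intro t ht
        rw [interior_Icc] at ht ⊢
        have hsub' : Ioo z x ⊆ Icc z B := Ioo_subset_Icc_self.trans hsub
        have h1 := (hF t (hsub' ht)).mono hsub'
        have h2 : HasDerivAt (fun t => p * t) p t := by
          simpa using (hasDerivAt_id t).const_mul p
        exact h2.hasDerivWithinAt.sub h1
      · intro t ht
        rw [interior_Icc] at ht
        have := hmono t ⟨ht.1.le, ht.2.le.trans hx.2⟩ x hx ht.2.le
        linarith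
    have := hmon (left_mem_Icc.2 hzx.le) (right_mem_Icc.2 hzx.le) hzx.le
    simp only at this
    linarith
  have h5 : |F z + c| ≤ ψ + (F x - F z) := by
    rw [abs_le]; constructor <;> linarith
  have h6 : |F z + c| / 2 ≤ p * (x - z) := by linarith
  have h7 : b * |F z + c| ≤ 2 * p ^ 2 := by
    have : b * (p * (x - z)) ≤ p * p := by
      calc b * (p * (x - z)) = p * (b * (x - z)) := by ring
        _ ≤ p * p := by gcongr
    nlinarith [mul_le_mul_of_nonneg_left h6 hb.le]
  have h8 : p * (y - x) ≤ 2 * ψ := by linarith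
  have h9 : (p * (y - x)) ^ 2 ≤ (2 * ψ) ^ 2 :=
    pow_le_pow_left₀ (by positivity) h8 2
  calc b * |F z + c| * (y - x) ^ 2 ≤ 2 * p ^ 2 * (y - x) ^ 2 := by gcongr
    _ = 2 * (p * (y - x)) ^ 2 := by ring
    _ ≤ 8 * ψ ^ 2 := by linarith

/-- A function on `[A, B]` whose derivative increases with slope at least `b` has a point `z`, a
zero of the derivative or an endpoint, such that the sublevel sets on either side of `z` are
short. -/
theorem exists_sublevel_point {A B b : ℝ} {F F₁ : ℝ → ℝ} (hAB : A ≤ B) (hb : 0 < b)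
    (hF : ∀ x ∈ Icc A B, HasDerivWithinAt F (F₁ x) (Icc A B) x)
    (hcont : ContinuousOn F₁ (Icc A B))
    (hslope : ∀ x ∈ Icc A B, ∀ y ∈ Icc A B, x ≤ y → b * (y - x) ≤ F₁ y - F₁ x) :
    ∃ z ∈ Icc A B, ∀ x ∈ Icc A B, ∀ y ∈ Icc A B, (z ≤ x ∧ z ≤ y ∨ x ≤ z ∧ y ≤ z) →
      ∀ c ψ : ℝ, |F x + c| < ψ → |F y + c| < ψ →
      |F₁ z| * |x - y| ≤ 2 * ψ ∧ b * |x - y| ^ 2 ≤ 4 * ψ ∧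
        (2 * ψ ≤ |F z + c| → b * |F z + c| * |x - y| ^ 2 ≤ 8 * ψ ^ 2) := by
  have hmono : ∀ x ∈ Icc A B, ∀ y ∈ Icc A B, x ≤ y → F₁ x ≤ F₁ y := by
    intro x hx y hy hxy
    have := hslope x hx y hy hxy
    have : 0 ≤ b * (y - x) := mul_nonneg hb.le (by linarith)
    linarith
  have hAm : A ∈ Icc A B := left_mem_Icc.2 hAB
  have hBm : B ∈ Icc A B := right_mem_Icc.2 hAB
  obtain ⟨z, hz, hz1, hz2⟩ : ∃ z ∈ Icc A B,
      (∀ x ∈ Icc A B, z < x → |F₁ z| + b * (x - z) ≤ F₁ x) ∧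
      (∀ x ∈ Icc A B, x < z → F₁ x ≤ -|F₁ z| - b * (z - x)) := by
    rcases le_or_gt 0 (F₁ A) with h | h
    · refine ⟨A, hAm, fun x hx hxA => ?_, fun x hx hxA => absurd hx.1 (not_le.2 hxA)⟩
      rw [abs_of_nonneg h]
      linarith [hslope A hAm x hx hxA.le]
    rcases le_or_gt (F₁ B) 0 with h' | h'
    · refine ⟨B, hBm, fun x hx hxB => absurd hx.2 (not_le.2 hxB), fun x hx hxB => ?_⟩
      rw [abs_of_nonpos h']
      linarith [hslope x hx B hBm hxB.le]
    · obtain ⟨z, hz, hz0⟩ := intermediate_value_Icc hAB hcont ⟨h.le, h'.le⟩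
      refine ⟨z, hz, fun x hx hxz => ?_, fun x hx hxz => ?_⟩
      · rw [hz0, abs_zero]
        linarith [hslope z hz x hx hxz.le]
      · rw [hz0, abs_zero]
        linarith [hslope x hx z hz hxz.le]
  refine ⟨z, hz, ?_⟩
  -- it is enough to treat `x ≤ y`
  suffices H : ∀ x ∈ Icc A B, ∀ y ∈ Icc A B, x ≤ y → (z ≤ x ∧ z ≤ y ∨ x ≤ z ∧ y ≤ z) →
      ∀ c ψ : ℝ, |F x + c| < ψ → |F y + c| < ψ →
      |F₁ z| * (y - x) ≤ 2 * ψ ∧ b * (y - x) ^ 2 ≤ 4 * ψ ∧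
        (2 * ψ ≤ |F z + c| → b * |F z + c| * (y - x) ^ 2 ≤ 8 * ψ ^ 2) by
    intro x hx y hy hside c ψ h1 h2
    rcases le_total x y with h | h
    · rw [abs_sub_comm, abs_of_nonneg (sub_nonneg.2 h)]
      exact H x hx y hy h hside c ψ h1 h2
    · rw [abs_of_nonneg (sub_nonneg.2 h)]
      exact H y hy x hx h (by tauto) c ψ h2 h1
  rintro x hx y hy hxy (⟨hzx, hzy⟩ | ⟨hxz, hyz⟩) c ψ h1 h2
  · have hsub : Icc z B ⊆ Icc A B := Icc_subset_Icc hz.1 le_rfl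
    exact sublevel_right hb (abs_nonneg _) (fun t ht => (hF t (hsub ht)).mono hsub)
      (fun u hu v hv => hmono u (hsub hu) v (hsub hv)) (fun u hu => hz1 u (hsub hu))
      ⟨hzx, hx.2⟩ ⟨hzy, hy.2⟩ hxy h1 h2
  · -- reflect the left side
    have hmaps : MapsTo (fun t : ℝ => -t) (Icc (-z) (-A)) (Icc A B) := fun t ht =>
      ⟨by linarith [ht.2], by linarith [ht.1, hz.2]⟩
    have := sublevel_right (F := fun t => F (-t)) (F₁ := fun t => -F₁ (-t)) (c := c) (ψ := ψ)
      (z := -z) (B := -A) hb (abs_nonneg (F₁ z)) (fun t ht => by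
        have h3 := (hF (-t) (hmaps ht)).comp t ((hasDerivAt_neg t).hasDerivWithinAt) hmaps
        refine h3.congr_deriv (by ring))
      (fun u hu v hv huv => by
        have := hmono (-v) (hmaps hv) (-u) (hmaps hu) (by linarith)
        linarith)
      (fun u hu hzu => by
        have := hz2 (-u) (hmaps hu) (by linarith)
        linarith) (x := -y) (y := -x) ⟨by linarith, by linarith [hy.1]⟩
      ⟨by linarith, by linarith [hx.1]⟩ (by linarith) (by simpa using h2) (by simpa using h1)
    simp only [neg_neg] at this
    have e : -x - -y = y - x := by ring
    rwa [e] at this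

/-! ### Summation over the integer translates -/

theorem sum_rpow_neg_le {σ : ℝ} (h0 : 0 ≤ σ) (h1 : σ < 1) (N : ℕ) :
    ∑ n ∈ Finset.range N, ((n : ℝ) + 1) ^ (-σ) ≤ (N : ℝ) ^ (1 - σ) / (1 - σ) := by
  have hσ : 0 < 1 - σ := by linarith
  induction N with
  | zero => simp; positivity
  | succ N ih =>
    rw [Finset.sum_range_succ]
    have hN : (0 : ℝ) < (N : ℝ) + 1 := by positivity
    -- Bernoulli's inequality for the exponent `1 - σ ≤ 1`
    have hb := rpow_one_add_le_one_add_mul_self (s := -(1 / ((N : ℝ) + 1)))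
      (by rw [neg_le_neg_iff, div_le_one hN]; linarith [(Nat.cast_nonneg N : (0 : ℝ) ≤ N)])
      hσ.le (by linarith)
    have e1 : 1 + -(1 / ((N : ℝ) + 1)) = N / (N + 1) := by field_simp; ring
    rw [e1, Real.div_rpow (Nat.cast_nonneg N) hN.le, div_le_iff₀ (Real.rpow_pos_of_pos hN _)] at hb
    have e2 : ((N : ℝ) + 1) ^ (-σ) = ((N : ℝ) + 1) ^ (1 - σ) / (N + 1) := by
      rw [← Real.rpow_sub_one hN.ne']; congr 1; ring
    rw [le_div_iff₀ hσ] at ih ⊢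
    rw [add_mul, e2]
    push_cast
    have e3 : (1 + (1 - σ) * -(1 / ((N : ℝ) + 1))) * ((N : ℝ) + 1) ^ (1 - σ)
        = ((N : ℝ) + 1) ^ (1 - σ) - ((N : ℝ) + 1) ^ (1 - σ) / (N + 1) * (1 - σ) := by
      ring
    linarith

open scoped ENNReal in
/-- A series over the integers, supported on `[-N, N]`, with terms `O(|k|^{-σ})` away from `0`. -/
theorem tsum_int_le {σ D c : ℝ} (h0 : 0 ≤ σ) (h1 : σ < 1) (hD : 0 ≤ D) (hc : 0 ≤ c) (N : ℕ)
    (g : ℤ → ℝ≥0∞) (hg0 : g 0 ≤ ENNReal.ofReal c)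
    (hg : ∀ k : ℤ, k ≠ 0 → g k ≤ ENNReal.ofReal (D * |(k : ℝ)| ^ (-σ)))
    (hN : ∀ k : ℤ, (N : ℤ) < |k| → g k = 0) :
    ∑' k, g k ≤ ENNReal.ofReal (c + 2 * D * ((N : ℝ) ^ (1 - σ) / (1 - σ))) := by
  have key : ∀ g' : ℕ → ℝ≥0∞,
      (∀ n : ℕ, g' n ≤ ENNReal.ofReal (D * ((n : ℝ) + 1) ^ (-σ))) → (∀ n, N ≤ n → g' n = 0) →
      ∑' n, g' n ≤ ENNReal.ofReal (D * ((N : ℝ) ^ (1 - σ) / (1 - σ))) := by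
    intro g' hg' hN'
    rw [tsum_eq_sum (s := Finset.range N) fun n hn => hN' n (by simpa using hn)]
    refine (Finset.sum_le_sum fun n _ => hg' n).trans ?_
    rw [← ENNReal.ofReal_sum_of_nonneg fun n _ => by positivity, ← Finset.mul_sum]
    exact ENNReal.ofReal_le_ofReal (mul_le_mul_of_nonneg_left (sum_rpow_neg_le h0 h1 N) hD)
  rw [tsum_of_nat_of_neg_add_one ENNReal.summable ENNReal.summable,
    tsum_eq_zero_add' ENNReal.summable]
  have hpos : 0 ≤ D * ((N : ℝ) ^ (1 - σ) / (1 - σ)) := by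
    have : 0 < 1 - σ := by linarith
    positivity
  have e : c + 2 * D * ((N : ℝ) ^ (1 - σ) / (1 - σ)) = c + D * ((N : ℝ) ^ (1 - σ) / (1 - σ))
      + D * ((N : ℝ) ^ (1 - σ) / (1 - σ)) := by ring
  rw [e, ENNReal.ofReal_add (by positivity) hpos, ENNReal.ofReal_add hc hpos]
  gcongr
  · exact_mod_cast hg0
  · refine key _ (fun n => ?_) fun n hn => hN _ ?_
    · have := hg ((n + 1 : ℕ) : ℤ) (by omega)
      push_cast at this ⊢
      rwa [abs_of_pos (by positivity)] at this
    · rw [abs_of_nonneg (by positivity)]; omega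
  · refine key _ (fun n => ?_) fun n hn => hN _ ?_
    · have := hg (-((n : ℤ) + 1)) (by omega)
      push_cast at this ⊢
      rwa [abs_neg, abs_of_pos (by positivity)] at this
    · rw [abs_neg, abs_of_nonneg (by positivity)]; omega

/-! ### The covering for a single pair -/

/-- The restriction to the curve of the form `a₁ X + a₂ Y`, shifted by `l`. -/
def curveForm (f l : ℝ → ℝ) (a : ℤ × ℤ) (x : ℝ) : ℝ := (a.2 : ℝ) * f x + a.1 * x + l x

theorem abs_fst_le_supNorm (a : ℤ × ℤ) : |(a.1 : ℝ)| ≤ supNorm a := by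
  have : a.1.natAbs ≤ supNorm a := le_max_left _ _
  rw [← Int.cast_abs, Int.abs_eq_natAbs, Int.cast_natCast]
  exact_mod_cast this

theorem abs_snd_le_supNorm (a : ℤ × ℤ) : |(a.2 : ℝ)| ≤ supNorm a := by
  have : a.2.natAbs ≤ supNorm a := le_max_right _ _
  rw [← Int.cast_abs, Int.abs_eq_natAbs, Int.cast_natCast]
  exact_mod_cast this

theorem supNorm_eq_or (a : ℤ × ℤ) :
    (supNorm a : ℝ) = |(a.1 : ℝ)| ∨ (supNorm a : ℝ) = |(a.2 : ℝ)| := by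
  rw [← Int.cast_abs, ← Int.cast_abs, Int.abs_eq_natAbs, Int.abs_eq_natAbs, Int.cast_natCast,
    Int.cast_natCast]
  rcases max_choice a.1.natAbs a.2.natAbs with h | h
  · left; exact_mod_cast h
  · right; exact_mod_cast h

theorem curveForm_hasDeriv {A B C : ℝ} {f f₁ l l₁ : ℝ → ℝ} (hf : IsC11 A B C f f₁)
    (hl : IsC11 A B C l l₁) (a : ℤ × ℤ) {x : ℝ} (hx : x ∈ Icc A B) :
    HasDerivWithinAt (curveForm f l a) ((a.2 : ℝ) * f₁ x + a.1 + l₁ x) (Icc A B) x := by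
  have := form_hasDeriv hf hl 0 a.1 a.2 hx
  simp only [add_zero] at this
  exact this

theorem abs_curveForm_le {A B C : ℝ} {f f₁ l l₁ : ℝ → ℝ} (hf : IsConvexArc A B C f f₁)
    (hl : IsC11 A B C l l₁) (a : ℤ × ℤ) (ha : 1 ≤ supNorm a) {x : ℝ} (hx : x ∈ Icc A B) :
    |curveForm f l a x| ≤ 3 * C * supNorm a := by
  have hC := hf.one_le
  have hq : (1 : ℝ) ≤ supNorm a := by exact_mod_cast ha
  have h1 : |(a.2 : ℝ) * f x| ≤ supNorm a * C := by
    rw [abs_mul]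
    exact mul_le_mul (abs_snd_le_supNorm a) (hf.bound x hx) (abs_nonneg _) (by linarith)
  have h2 : |(a.1 : ℝ) * x| ≤ supNorm a * C := by
    rw [abs_mul]
    exact mul_le_mul (abs_fst_le_supNorm a) (hf.abs_le x hx) (abs_nonneg _) (by linarith)
  have h3 := hl.bound x hx
  have h4 : C ≤ supNorm a * C := le_mul_of_one_le_left (by linarith) hq
  calc |curveForm f l a x| ≤ _ := abs_add_three _ _ _
    _ ≤ 3 * C * supNorm a := by linarith

theorem IsC11.continuousOn_deriv {A B C : ℝ} {l l₁ : ℝ → ℝ} (hl : IsC11 A B C l l₁) (hC : 0 ≤ C) :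
    ContinuousOn l₁ (Icc A B) := by
  have : LipschitzOnWith (Real.toNNReal C) l₁ (Icc A B) := by
    refine LipschitzOnWith.of_dist_le_mul fun x hx y hy => ?_
    rw [Real.dist_eq, Real.dist_eq, Real.coe_toNNReal C hC]
    exact hl.lip x hx y hy
  exact this.continuousOn

/-- For a pair `a` with large norm `q`, either the form has derivative at least `q / 2` everywhere,
or its derivative is monotone with slope comparable to `q`.  Either way the sublevel sets on
either side of some point `z` are controlled. -/
theorem exists_turning_point {A B C : ℝ} {f f₁ l l₁ : ℝ → ℝ} (hf : IsConvexArc A B C f f₁)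
    (hl : IsC11 A B C l l₁) (hAB : A ≤ B) (a : ℤ × ℤ) (hq : 6 * C ^ 3 ≤ supNorm a) :
    ∃ z ∈ Icc A B, (∀ x ∈ Icc A B, ∀ y ∈ Icc A B, ∀ c ψ : ℝ,
        |curveForm f l a x + c| < ψ → |curveForm f l a y + c| < ψ →
        supNorm a / 2 * |x - y| ≤ 2 * ψ) ∨
      ∀ x ∈ Icc A B, ∀ y ∈ Icc A B, (z ≤ x ∧ z ≤ y ∨ x ≤ z ∧ y ≤ z) → ∀ c ψ : ℝ,
        |curveForm f l a x + c| < ψ → |curveForm f l a y + c| < ψ →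
        |(a.2 : ℝ) * f₁ z + a.1 + l₁ z| * |x - y| ≤ 2 * ψ ∧
        supNorm a / (6 * C ^ 2) * |x - y| ^ 2 ≤ 4 * ψ ∧
        (2 * ψ ≤ |curveForm f l a z + c| →
          supNorm a / (6 * C ^ 2) * |curveForm f l a z + c| * |x - y| ^ 2 ≤ 8 * ψ ^ 2) := by
  have hC := hf.one_le
  have hC0 : 0 < C := by linarith
  set q : ℝ := (supNorm a : ℝ) with hqdef
  have hC3 : C ≤ C ^ 3 := le_self_pow₀ hC (by norm_num)
  have hq0 : 0 < q := by linarith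
  set F := curveForm f l a with hF
  set F₁ : ℝ → ℝ := fun x => (a.2 : ℝ) * f₁ x + a.1 + l₁ x with hF₁
  have hder : ∀ x ∈ Icc A B, HasDerivWithinAt F (F₁ x) (Icc A B) x := fun x hx =>
    curveForm_hasDeriv hf.toIsC11 hl a hx
  have hcontF : ContinuousOn F (Icc A B) := fun x hx => (hder x hx).continuousWithinAt
  have hcont : ContinuousOn F₁ (Icc A B) :=
    ((continuousOn_const.mul (hf.toIsC11.continuousOn_deriv hC0.le)).add continuousOn_const).add
      (hl.continuousOn_deriv hC0.le)
  by_cases hcase : 3 * C * |(a.2 : ℝ)| ≤ |(a.1 : ℝ)|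
  · refine ⟨A, left_mem_Icc.2 hAB, Or.inl fun x hx y hy c ψ h1 h2 => ?_⟩
    have ha1 : q = |(a.1 : ℝ)| := by
      rcases supNorm_eq_or a with h | h
      · exact h
      · have h3 : |(a.2 : ℝ)| = q := h.symm
        rw [h3] at hcase
        have := abs_fst_le_supNorm a
        nlinarith
    have hbig : ∀ t ∈ Icc A B, |F₁ t - a.1| ≤ q / 2 := by
      intro t ht
      have e1 : |(a.2 : ℝ) * f₁ t| ≤ |(a.2 : ℝ)| * C := by
        rw [abs_mul]
        exact mul_le_mul_of_nonneg_left (hf.bound_deriv t ht) (abs_nonneg _)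
      have e2 := hl.bound_deriv t ht
      have e3 : F₁ t - a.1 = (a.2 : ℝ) * f₁ t + l₁ t := by simp only [hF₁]; ring
      rw [e3]
      have := abs_add_le ((a.2 : ℝ) * f₁ t) (l₁ t)
      have : C ≤ q / 6 := by linarith
      linarith
    -- the mean value theorem
    wlog hxy : x < y generalizing x y
    · rcases eq_or_lt_of_le (not_lt.1 hxy) with h | h
      · rw [h, sub_self, abs_zero, mul_zero]
        linarith [(abs_nonneg _).trans_lt h1]
      · rw [abs_sub_comm]; exact this y hy x hx h2 h1 h
    have hsub : Icc x y ⊆ Icc A B := Icc_subset_Icc hx.1 hy.2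
    obtain ⟨t, ht, hteq⟩ := exists_hasDerivAt_eq_slope F F₁ hxy (hcontF.mono hsub) fun t ht =>
      (hder t (hsub (Ioo_subset_Icc_self ht))).hasDerivAt
        (Icc_mem_nhds (hx.1.trans_lt ht.1) (ht.2.trans_le hy.2))
    have h3 : q / 2 ≤ |F₁ t| := by
      have h4 := hbig t (hsub (Ioo_subset_Icc_self ht))
      have h5 := abs_sub_abs_le_abs_sub (a.1 : ℝ) (F₁ t)
      rw [abs_sub_comm] at h5
      linarith
    have hyx : 0 < y - x := by linarith
    rw [hteq, abs_div, abs_of_pos hyx, le_div_iff₀ hyx] at h3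
    rw [abs_sub_comm, abs_of_pos hyx]
    have h6 := abs_sub (F y + c) (F x + c)
    have h7 : F y + c - (F x + c) = F y - F x := by ring
    rw [h7] at h6
    linarith
  · push Not at hcase
    have ha2 : q ≤ 3 * C * |(a.2 : ℝ)| := by
      rcases supNorm_eq_or a with h | h
      · linarith
      · have h3 : q = |(a.2 : ℝ)| := h
        rw [← h3]; nlinarith
    have ha2' : 2 * C ^ 2 ≤ |(a.2 : ℝ)| := by
      have : 3 * C * (2 * C ^ 2) ≤ 3 * C * |(a.2 : ℝ)| := by linarith
      exact le_of_mul_le_mul_left this (by positivity)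
    have hb : 0 < q / (6 * C ^ 2) := by positivity
    -- slope of the derivative when the sign of `a₂` is normalized
    have hslope : ∀ x ∈ Icc A B, ∀ y ∈ Icc A B, x ≤ y → ∀ ε : ℝ, |ε| = 1 → ε * a.2 = |(a.2 : ℝ)| →
        q / (6 * C ^ 2) * (y - x) ≤ ε * F₁ y - ε * F₁ x := by
      intro x hx y hy hxy ε hε hεa
      have e1 := hf.le_sub x hx y hy hxy
      have e2 := hl.lip y hy x hx
      rw [abs_of_nonneg (sub_nonneg.2 hxy)] at e2
      have e3 : |ε * (l₁ y - l₁ x)| ≤ C * (y - x) := by rwa [abs_mul, hε, one_mul]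
      have e4 := (abs_le.1 e3).1
      have e5 : ε * F₁ y - ε * F₁ x = |(a.2 : ℝ)| * (f₁ y - f₁ x) + ε * (l₁ y - l₁ x) := by
        rw [← hεa]; simp only [hF₁]; ring
      rw [e5]
      have e6 : |(a.2 : ℝ)| * ((y - x) / C) ≤ |(a.2 : ℝ)| * (f₁ y - f₁ x) := by
        gcongr; rw [div_le_iff₀ hC0]; linarith
      have hyx : 0 ≤ y - x := by linarith
      have e7 : C * (y - x) ≤ |(a.2 : ℝ)| / (2 * C) * (y - x) := by
        gcongr; rw [le_div_iff₀ (by positivity)]; nlinarith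
      have e8 : q / (6 * C ^ 2) * (y - x) ≤ |(a.2 : ℝ)| / (2 * C) * (y - x) := by
        gcongr ?_ * _
        rw [div_le_div_iff₀ (by positivity) (by positivity)]
        calc q * (2 * C) ≤ 3 * C * |(a.2 : ℝ)| * (2 * C) := by gcongr
          _ = _ := by ring
      have e9 : |(a.2 : ℝ)| * ((y - x) / C) = 2 * (|(a.2 : ℝ)| / (2 * C) * (y - x)) := by
        field_simp
      linarith
    rcases le_or_gt 0 (a.2 : ℝ) with hs | hs
    · obtain ⟨z, hz, H⟩ := exists_sublevel_point hAB hb hder hcont fun x hx y hy hxy => by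
        have := hslope x hx y hy hxy 1 (by simp) (by rw [one_mul, abs_of_nonneg hs])
        simpa only [one_mul] using this
      exact ⟨z, hz, Or.inr H⟩
    · obtain ⟨z, hz, H⟩ := exists_sublevel_point (F := fun x => -F x) (F₁ := fun x => -F₁ x)
        hAB hb (fun x hx => (hder x hx).neg) hcont.neg fun x hx y hy hxy => by
          have := hslope x hx y hy hxy (-1) (by simp) (by rw [neg_one_mul, abs_of_neg hs])
          simpa only [neg_one_mul] using this
      refine ⟨z, hz, Or.inr fun x hx y hy hside c ψ h1 h2 => ?_⟩
      have hneg : ∀ t, |-F t + -c| = |F t + c| := fun t => by rw [← abs_neg]; congr 1; ring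
      have := H x hx y hy hside (-c) ψ (by rwa [hneg]) (by rwa [hneg])
      rwa [hneg, abs_neg] at this

theorem rpow_le_self_of_le_one {c s : ℝ} (hc : 1 ≤ c) (hs1 : s ≤ 1) : c ^ s ≤ c := by
  calc c ^ s ≤ c ^ (1 : ℝ) := Real.rpow_le_rpow_of_exponent_le hc hs1
    _ = c := Real.rpow_one c

/-- A sublevel set of a form that is not near a double zero is as short as if the derivative were
of size `1 / t²`: here `μ` and `m` are the sizes of the derivative and of the form at the turning
point, and `d` is a distance of two points of the set. -/
theorem abs_le_of_not_near {C q Q t ψ μ m d : ℝ} (hC : 1 ≤ C) (hq0 : 0 < q) (hQq : Q ≤ 2 * q)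
    (hQ0 : 0 < Q) (ht : 1 ≤ t) (hψ0 : 0 ≤ ψ) (hψ2 : 2 * ψ ≤ Q * (1 / (100 * C) / t ^ 2 / Q) ^ 2)
    (hd : 0 ≤ d) (h1 : μ * d ≤ 2 * ψ) (h2 : 2 * ψ ≤ m → q / (6 * C ^ 2) * m * d ^ 2 ≤ 8 * ψ ^ 2)
    (hnot : ¬ (μ ≤ Q * (1 / (100 * C) / t ^ 2 / Q) ∧ m ≤ Q * (1 / (100 * C) / t ^ 2 / Q) ^ 2)) :
    d ≤ 1000 * C ^ 2 * t ^ 2 * ψ := by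
  have hC0 : 0 < C := by linarith
  have ht0 : 0 < t := by linarith
  have hQρ : Q * (1 / (100 * C) / t ^ 2 / Q) = 1 / (100 * C * t ^ 2) := by field_simp
  have hQρ2 : Q * (1 / (100 * C) / t ^ 2 / Q) ^ 2 = 1 / (10000 * C ^ 2 * t ^ 4 * Q) := by
    field_simp; norm_num
  rw [hQρ, hQρ2, not_and_or, not_le, not_le] at hnot
  rw [hQρ2] at hψ2
  rcases hnot with h | h
  · have h3 : 1 / (100 * C * t ^ 2) * d ≤ 2 * ψ :=
      (mul_le_mul_of_nonneg_right h.le hd).trans h1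
    rw [div_mul_eq_mul_div, one_mul, div_le_iff₀ (by positivity)] at h3
    have h5 : C * (t ^ 2 * ψ) ≤ C ^ 2 * (t ^ 2 * ψ) := by
      gcongr; exact le_self_pow₀ hC (by norm_num)
    have : 0 ≤ C ^ 2 * (t ^ 2 * ψ) := by positivity
    linarith
  · have h3 := h2 (hψ2.trans h.le)
    have h4 : q / (6 * C ^ 2) * (1 / (10000 * C ^ 2 * t ^ 4 * Q)) * d ^ 2 ≤ 8 * ψ ^ 2 := by
      refine le_trans ?_ h3
      gcongr
    have h5 : 1 / (120000 * C ^ 4 * t ^ 4) ≤ q / (6 * C ^ 2) * (1 / (10000 * C ^ 2 * t ^ 4 * Q)) := by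
      rw [div_mul_div_comm, mul_one, div_le_div_iff₀ (by positivity) (by positivity)]
      calc 1 * (6 * C ^ 2 * (10000 * C ^ 2 * t ^ 4 * Q))
          = 60000 * C ^ 4 * t ^ 4 * Q := by ring
        _ ≤ 60000 * C ^ 4 * t ^ 4 * (2 * q) := by gcongr
        _ = _ := by ring
    have h6 : 1 / (120000 * C ^ 4 * t ^ 4) * d ^ 2 ≤ 8 * ψ ^ 2 :=
      (mul_le_mul_of_nonneg_right h5 (by positivity)).trans h4
    rw [div_mul_eq_mul_div, one_mul, div_le_iff₀ (by positivity)] at h6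
    refine abs_le_of_sq_le_sq' ?_ (by positivity) |>.2
    have h7 : 0 ≤ C ^ 4 * t ^ 4 * ψ ^ 2 := by positivity
    have h8 : (1000 * C ^ 2 * t ^ 2 * ψ) ^ 2 = 1000000 * (C ^ 4 * t ^ 4 * ψ ^ 2) := by ring
    linarith

set_option maxHeartbeats 1000000 in
/-- The total cost of the sublevel sets of all integer translates for a pair `a`, on one side of
its turning point.  Here `q = |a|`, and `Q`, `t` are the parameters of the count of near pairs. -/
theorem tsum_ediam_le {A B C s : ℝ} {f f₁ l l₁ : ℝ → ℝ} (hf : IsConvexArc A B C f f₁)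
    (hl : IsC11 A B C l l₁) (hAB : A ≤ B) (hs0 : 0 < s) (hs1 : s < 1) (a : ℤ × ℤ)
    (hq : 6 * C ^ 3 ≤ supNorm a) {ψ Q t : ℝ} (hψ0 : 0 < ψ) (hψ1 : ψ ≤ 1 / 4)
    (hqQ : (supNorm a : ℝ) ≤ Q) (hQq : Q ≤ 2 * supNorm a) (ht : 1 ≤ t)
    (hts : (t ^ 2) ^ s ≤ 2 * (supNorm a : ℝ) ^ (1 - s))
    (hψ2 : 2 * ψ ≤ Q * (1 / (100 * C) / t ^ 2 / Q) ^ 2) :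
    ∃ z : ℝ, ∀ Side : Set ℝ, Side = Ici z ∨ Side = Iic z →
      ∑' a₀ : ℤ, Metric.ediam {x ∈ Icc A B | x ∈ Side ∧ |curveForm f l a x + a₀| < ψ} ^ s
        ≤ ENNReal.ofReal (3000 * C ^ 3 * (ψ ^ s * (supNorm a : ℝ) ^ (1 - s)) +
          {a | a ∈ nearPairs A B f f₁ l l₁ Q (1 / (100 * C) / t ^ 2 / Q)}.indicator
            (fun a => 24 * C ^ 2 * (ψ / supNorm a) ^ (s / 2)) a) := by
  classical
  have hC := hf.one_le
  have hC0 : 0 < C := by linarith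
  obtain ⟨z, hz, H⟩ := exists_turning_point hf hl hAB a hq
  set q : ℝ := (supNorm a : ℝ) with hqdef
  have hC3 : 1 ≤ C ^ 3 := one_le_pow₀ hC
  have hq1 : 1 ≤ q := by linarith
  have hq0 : 0 < q := by linarith
  have hQ0 : 0 < Q := by linarith
  have ht0 : 0 < t := by linarith
  have hqN : 1 ≤ supNorm a := by rw [hqdef] at hq1; exact_mod_cast hq1
  set F := curveForm f l a with hF
  set k₀ : ℤ := -round (F z) with hk₀
  have hround : |F z + k₀| ≤ 1 / 2 := by
    have := abs_sub_round (F z)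
    rw [hk₀]; push_cast; rwa [← sub_eq_add_neg]
  have hFz : |F z| ≤ 3 * C * q := abs_curveForm_le hf hl a hqN hz
  have hCq : 1 ≤ C * q := one_le_mul_of_one_le_of_one_le hC hq1
  have hψpos : 0 < ψ ^ s := Real.rpow_pos_of_pos hψ0 s
  have hqpos : 0 < q ^ (1 - s) := Real.rpow_pos_of_pos hq0 _
  refine ⟨z, fun Side hSide => ?_⟩
  set E : ℤ → Set ℝ := fun a₀ => {x ∈ Icc A B | x ∈ Side ∧ |F x + a₀| < ψ} with hE
  have hside : ∀ x ∈ Side, ∀ y ∈ Side, (z ≤ x ∧ z ≤ y ∨ x ≤ z ∧ y ≤ z) := by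
    rcases hSide with rfl | rfl
    · exact fun x hx y hy => Or.inl ⟨hx, hy⟩
    · exact fun x hx y hy => Or.inr ⟨hx, hy⟩
  -- index the translates by their distance to the one that is smallest at `z`
  rw [← (Equiv.addRight k₀).tsum_eq]
  simp only [Equiv.coe_addRight]
  set N : ℕ := ⌊8 * C * q⌋₊ with hN
  have hNle : (N : ℝ) ≤ 8 * C * q := Nat.floor_le (by positivity)
  have hempty : ∀ k : ℤ, (N : ℤ) < |k| → Metric.ediam (E (k + k₀)) ^ s = 0 := by
    intro k hk
    have hemp : E (k + k₀) = ∅ := by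
      rw [Set.eq_empty_iff_forall_notMem]
      rintro x ⟨hx, -, hxψ⟩
      have h1 : |F x| ≤ 3 * C * q := abs_curveForm_le hf hl a hqN hx
      have h2 : 8 * C * q < |(k : ℝ)| := by
        rw [Int.abs_eq_natAbs, Nat.cast_lt] at hk
        have := (Nat.floor_lt' (n := k.natAbs) (a := 8 * C * q) (by omega)).1 hk
        rwa [← Int.cast_natCast, ← Int.abs_eq_natAbs, Int.cast_abs] at this
      have h3 : (k : ℝ) = (F x + ((k + k₀ : ℤ) : ℝ)) - (F z + k₀) + (F z - F x) := by
        push_cast; ring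
      have h4 := abs_add_le ((F x + ((k + k₀ : ℤ) : ℝ)) - (F z + k₀)) (F z - F x)
      rw [← h3] at h4
      have h5 := abs_sub (F x + ((k + k₀ : ℤ) : ℝ)) (F z + k₀)
      have h6 := abs_sub (F z) (F x)
      linarith
    rw [hemp, Metric.ediam_empty, ENNReal.zero_rpow_of_pos hs0]
  have hind : 0 ≤ {a | a ∈ nearPairs A B f f₁ l l₁ Q (1 / (100 * C) / t ^ 2 / Q)}.indicator
            (fun a => 24 * C ^ 2 * (ψ / supNorm a) ^ (s / 2)) a :=
    Set.indicator_nonneg (fun _ _ => by positivity) _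
  rcases H with H | H
  · -- large derivative
    set D := (4 * ψ / q) ^ s with hD
    have hd : ∀ k : ℤ, Metric.ediam (E (k + k₀)) ^ s ≤ ENNReal.ofReal D := by
      intro k
      refine ediam_rpow_le hs0 (fun x hx y hy => ?_) (by positivity)
      have := H x hx.1 y hy.1 _ ψ hx.2.2 hy.2.2
      rw [le_div_iff₀ hq0]
      linarith
    refine (tsum_int_le (σ := 0) le_rfl one_pos (by positivity : 0 ≤ D) (by positivity : 0 ≤ D) N
      (fun k => Metric.ediam (E (k + k₀)) ^ s) (hd 0) (fun k _ => ?_) hempty).trans ?_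
    · simpa using hd k
    · refine ENNReal.ofReal_le_ofReal ?_
      have e1 : D = 4 ^ s * (ψ ^ s / q ^ s) := by
        rw [hD, mul_div_assoc, Real.mul_rpow (by norm_num) (by positivity),
          Real.div_rpow hψ0.le hq0.le]
      have e2 : (4 : ℝ) ^ s ≤ 4 := rpow_le_self_of_le_one (by norm_num) hs1.le
      have e3 : q ^ (1 - s) = q / q ^ s := by rw [Real.rpow_sub hq0, Real.rpow_one]
      have e4 : D ≤ 4 * (ψ ^ s / q ^ s) := by rw [e1]; gcongr
      simp only [sub_zero, Real.rpow_one, div_one]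
      have e5 : D + 2 * D * N ≤ 4 * (ψ ^ s / q ^ s) * (17 * C * q) := by
        calc D + 2 * D * N = D * (1 + 2 * N) := by ring
          _ ≤ 4 * (ψ ^ s / q ^ s) * (17 * C * q) := by
            gcongr; linarith
      have e6 : 4 * (ψ ^ s / q ^ s) * (17 * C * q) = 68 * C * (ψ ^ s * q ^ (1 - s)) := by
        rw [e3]; ring
      have e7 : 68 * C * (ψ ^ s * q ^ (1 - s)) ≤ 3000 * C ^ 3 * (ψ ^ s * q ^ (1 - s)) := by
        gcongr
        · norm_num
        · exact le_self_pow₀ hC (by norm_num)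
      linarith
  · -- monotone derivative
    set b := q / (6 * C ^ 2) with hb
    have hb0 : 0 < b := by positivity
    set D := 4 ^ s * ψ ^ s * b ^ (-(s / 2)) with hD
    have hD0 : 0 ≤ D := by positivity
    have hfar : ∀ k : ℤ, k ≠ 0 →
        Metric.ediam (E (k + k₀)) ^ s ≤ ENNReal.ofReal (D * |(k : ℝ)| ^ (-(s / 2))) := by
      intro k hk
      have hk1 : (1 : ℝ) ≤ |(k : ℝ)| := by exact_mod_cast Int.one_le_abs hk
      have hk0 : 0 < |(k : ℝ)| := by linarith
      have hm : |(k : ℝ)| / 2 ≤ |F z + ((k + k₀ : ℤ) : ℝ)| := by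
        have h3 : F z + ((k + k₀ : ℤ) : ℝ) = k + (F z + k₀) := by push_cast; ring
        have := abs_sub_abs_le_abs_add (k : ℝ) (F z + k₀)
        rw [h3]
        linarith
      have hdd : D * |(k : ℝ)| ^ (-(s / 2)) = (4 * ψ / √(b * |(k : ℝ)|)) ^ s := by
        rw [Real.div_rpow (by positivity) (Real.sqrt_nonneg _),
          Real.mul_rpow (by norm_num) hψ0.le, Real.sqrt_eq_rpow, ← Real.rpow_mul (by positivity),
          Real.mul_rpow hb0.le hk0.le, hD, Real.rpow_neg hb0.le, Real.rpow_neg hk0.le]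
        have : 1 / 2 * s = s / 2 := by ring
        rw [this]
        field_simp
      rw [hdd]
      refine ediam_rpow_le hs0 (fun x hx y hy => ?_) (by positivity)
      have h1 := (H x hx.1 y hy.1 (hside x hx.2.1 y hy.2.1) _ ψ hx.2.2 hy.2.2).2.2 (by linarith)
      have h2 : b * (|(k : ℝ)| / 2) * |x - y| ^ 2 ≤ 8 * ψ ^ 2 := by
        refine le_trans ?_ h1; gcongr
      rw [le_div_iff₀ (by positivity)]
      refine abs_le_of_sq_le_sq' ?_ (by positivity) |>.2
      rw [mul_pow, Real.sq_sqrt (by positivity)]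
      linarith
    obtain ⟨c, hc0, hzero, hcle⟩ : ∃ c : ℝ, 0 ≤ c ∧
        Metric.ediam (E (0 + k₀)) ^ s ≤ ENNReal.ofReal c ∧
        c ≤ 2000 * C ^ 2 * (ψ ^ s * q ^ (1 - s)) +
          {a | a ∈ nearPairs A B f f₁ l l₁ Q (1 / (100 * C) / t ^ 2 / Q)}.indicator
            (fun a => 24 * C ^ 2 * (ψ / supNorm a) ^ (s / 2)) a := by
      by_cases hbad : a ∈ nearPairs A B f f₁ l l₁ Q (1 / (100 * C) / t ^ 2 / Q)
      · refine ⟨√(24 * C ^ 2 * (ψ / q)) ^ s, by positivity, ?_, ?_⟩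
        · refine ediam_rpow_le hs0 (fun x hx y hy => ?_) (by positivity)
          have h1 := (H x hx.1 y hy.1 (hside x hx.2.1 y hy.2.1) _ ψ hx.2.2 hy.2.2).2.1
          apply Real.le_sqrt_of_sq_le
          rw [hb, div_mul_eq_mul_div, div_le_iff₀ (by positivity)] at h1
          rw [mul_div_assoc', le_div_iff₀ hq0]
          linarith
        · rw [Set.indicator_of_mem (by exact hbad)]
          have e1 : √(24 * C ^ 2 * (ψ / q)) ^ s
              = (24 * C ^ 2) ^ (s / 2) * (ψ / q) ^ (s / 2) := by
            rw [Real.sqrt_eq_rpow, ← Real.rpow_mul (by positivity),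
              ← Real.mul_rpow (by positivity) (by positivity)]
            congr 1; ring
          have e2 : (24 * C ^ 2) ^ (s / 2) ≤ 24 * C ^ 2 :=
            rpow_le_self_of_le_one (by nlinarith) (by linarith)
          have e3 : (24 * C ^ 2) ^ (s / 2) * (ψ / q) ^ (s / 2)
              ≤ 24 * C ^ 2 * (ψ / q) ^ (s / 2) := by gcongr
          rw [e1]
          have : 0 ≤ 2000 * C ^ 2 * (ψ ^ s * q ^ (1 - s)) := by positivity
          linarith
      · refine ⟨(1000 * C ^ 2 * t ^ 2 * ψ) ^ s, by positivity, ?_, ?_⟩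
        · refine ediam_rpow_le hs0 (fun x hx y hy => ?_) (by positivity)
          have h1 := H x hx.1 y hy.1 (hside x hx.2.1 y hy.2.1) _ ψ hx.2.2 hy.2.2
          have hnot : ¬ (|(a.2 : ℝ) * f₁ z + a.1 + l₁ z| ≤ Q * (1 / (100 * C) / t ^ 2 / Q) ∧
              |F z + k₀| ≤ Q * (1 / (100 * C) / t ^ 2 / Q) ^ 2) := by
            rintro ⟨h2, h3⟩
            refine hbad ⟨(abs_snd_le_supNorm a).trans hqQ, z, hz, k₀, h2, ?_⟩
            convert h3 using 2
            simp only [hF, curveForm]; ring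
          have hz0 : F z + ((0 + k₀ : ℤ) : ℝ) = F z + k₀ := by push_cast; ring
          rw [hz0] at h1
          exact abs_le_of_not_near hC hq0 hQq hQ0 ht hψ0.le hψ2 (abs_nonneg _) h1.1 h1.2.2 hnot
        · rw [Set.indicator_of_notMem (by exact hbad), add_zero,
            Real.mul_rpow (by positivity) hψ0.le, Real.mul_rpow (by positivity) (by positivity)]
          have e1 : (1000 * C ^ 2) ^ s ≤ 1000 * C ^ 2 := rpow_le_self_of_le_one (by nlinarith) hs1.le
          calc (1000 * C ^ 2) ^ s * (t ^ 2) ^ s * ψ ^ s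
              ≤ 1000 * C ^ 2 * (2 * q ^ (1 - s)) * ψ ^ s := by gcongr
            _ = _ := by ring
    refine (tsum_int_le (σ := s / 2) (by linarith) (by linarith) hD0 hc0 N
      (fun k => Metric.ediam (E (k + k₀)) ^ s) hzero hfar hempty).trans ?_
    refine ENNReal.ofReal_le_ofReal ?_
    have e1 : (N : ℝ) ^ (1 - s / 2) / (1 - s / 2) ≤ 2 * (8 * C * q) ^ (1 - s / 2) := by
      have h1 : (N : ℝ) ^ (1 - s / 2) ≤ (8 * C * q) ^ (1 - s / 2) :=
        Real.rpow_le_rpow (Nat.cast_nonneg N) hNle (by linarith)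
      rw [div_le_iff₀ (by linarith)]
      have : 0 ≤ (8 * C * q) ^ (1 - s / 2) := by positivity
      nlinarith
    have e2 : D * (8 * C * q) ^ (1 - s / 2)
        = 4 ^ s * (6 * C ^ 2) ^ (s / 2) * (8 * C) ^ (1 - s / 2) * (ψ ^ s * q ^ (1 - s)) := by
      rw [hD, hb, Real.div_rpow hq0.le (by positivity), Real.mul_rpow (by positivity) hq0.le,
        Real.rpow_neg hq0.le, Real.rpow_neg (by positivity)]
      have : q ^ (1 - s) = q ^ (1 - s / 2) / q ^ (s / 2) := by
        rw [← Real.rpow_sub hq0]; congr 1; ring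
      rw [this]
      field_simp
    have e3 : (4 : ℝ) ^ s * (6 * C ^ 2) ^ (s / 2) * (8 * C) ^ (1 - s / 2)
        ≤ 4 * (6 * C ^ 2) * (8 * C) := by
      gcongr
      · exact rpow_le_self_of_le_one (by norm_num) hs1.le
      · exact rpow_le_self_of_le_one (by nlinarith) (by linarith)
      · exact rpow_le_self_of_le_one (by linarith) (by linarith)
    have e4 := mul_le_mul_of_nonneg_right e3 (by positivity : 0 ≤ ψ ^ s * q ^ (1 - s))
    have e5 : 2 * D * ((N : ℝ) ^ (1 - s / 2) / (1 - s / 2))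
        ≤ 2 * D * (2 * (8 * C * q) ^ (1 - s / 2)) := by gcongr
    have e6 : 2000 * C ^ 2 * (ψ ^ s * q ^ (1 - s)) ≤ 2000 * C ^ 3 * (ψ ^ s * q ^ (1 - s)) := by
      gcongr ?_ * _
      have : C ^ 2 ≤ C ^ 3 := pow_le_pow_right₀ hC (by norm_num)
      linarith
    have e7 : 0 ≤ C ^ 3 * (ψ ^ s * q ^ (1 - s)) := by positivity
    nlinarith

/-! ### Summation over the pairs -/

/-- As `ψ` is decreasing, convergence of the series also bounds `n` times its `n`-th term. -/
theorem rpow_mul_rpow_bounded {ψ : ℕ → ℝ} (hψ : IsApproximatingFunction ψ) {s : ℝ} (hs0 : 0 < s)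
    (hs1 : s < 1) (hsum : Summable fun n : ℕ => ψ n ^ s * (n : ℝ) ^ (2 - s)) :
    ∃ K : ℝ, 0 < K ∧ ∀ n : ℕ, 1 ≤ n → ψ n ^ s * (n : ℝ) ^ (3 - s) ≤ K := by
  have hnn : ∀ n : ℕ, 0 ≤ ψ n ^ s * (n : ℝ) ^ (2 - s) := by
    intro n
    rcases Nat.eq_zero_or_pos n with rfl | hn
    · rw [Nat.cast_zero, Real.zero_rpow (by linarith), mul_zero]
    · have := (hψ.pos n hn).le
      positivity
  refine ⟨8 * ∑' n : ℕ, ψ n ^ s * (n : ℝ) ^ (2 - s) + 1, ?_, fun n hn => ?_⟩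
  · have : 0 ≤ ∑' n : ℕ, ψ n ^ s * (n : ℝ) ^ (2 - s) := tsum_nonneg hnn
    linarith
  have hnR : (0 : ℝ) < n := by exact_mod_cast hn
  have hψn := hψ.pos n hn
  have h1 := hsum.sum_le_tsum (Finset.Icc ((n + 1) / 2) n) fun i _ => hnn i
  have h2 : ∀ m ∈ Finset.Icc ((n + 1) / 2) n,
      ψ n ^ s * ((n : ℝ) ^ (2 - s) / 4) ≤ ψ m ^ s * (m : ℝ) ^ (2 - s) := by
    intro m hm
    obtain ⟨hm1, hm2⟩ := Finset.mem_Icc.1 hm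
    have hm0 : 1 ≤ m := by omega
    have hmn : (n : ℝ) / 2 ≤ m := by
      have : n ≤ 2 * m := by omega
      have : (n : ℝ) ≤ 2 * m := by exact_mod_cast this
      linarith
    have e1 : ψ n ^ s ≤ ψ m ^ s := Real.rpow_le_rpow hψn.le (hψ.anti m n hm0 hm2) hs0.le
    have e2 : (n : ℝ) ^ (2 - s) / 4 ≤ (m : ℝ) ^ (2 - s) := by
      calc (n : ℝ) ^ (2 - s) / 4 ≤ (n : ℝ) ^ (2 - s) / 2 ^ (2 - s) := by
            gcongr
            calc (2 : ℝ) ^ (2 - s) ≤ 2 ^ (2 : ℝ) :=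
                  Real.rpow_le_rpow_of_exponent_le (by norm_num) (by linarith)
              _ = 4 := by norm_num
        _ = ((n : ℝ) / 2) ^ (2 - s) := (Real.div_rpow hnR.le (by norm_num) _).symm
        _ ≤ (m : ℝ) ^ (2 - s) := Real.rpow_le_rpow (by positivity) hmn (by linarith)
    have := hψ.pos m hm0
    gcongr
  have h3 := (Finset.sum_le_sum h2).trans h1
  rw [Finset.sum_const, nsmul_eq_mul, Nat.card_Icc] at h3
  have h4 : (n : ℝ) / 2 ≤ ((n + 1 - (n + 1) / 2 : ℕ) : ℝ) := by
    have : n ≤ 2 * (n + 1 - (n + 1) / 2) := by omega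
    have : (n : ℝ) ≤ 2 * ((n + 1 - (n + 1) / 2 : ℕ) : ℝ) := by exact_mod_cast this
    linarith
  have h5 : (n : ℝ) / 2 * (ψ n ^ s * ((n : ℝ) ^ (2 - s) / 4))
      ≤ ((n + 1 - (n + 1) / 2 : ℕ) : ℝ) * (ψ n ^ s * ((n : ℝ) ^ (2 - s) / 4)) := by gcongr
  have h6 : ψ n ^ s * (n : ℝ) ^ (3 - s) = ψ n ^ s * ((n : ℝ) ^ (2 - s) * n) := by
    have : (3 : ℝ) - s = (2 - s) + 1 := by ring
    rw [this, Real.rpow_add_one hnR.ne']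
  rw [h6]
  linarith

theorem card_filter_supNorm_le (T : Finset (ℤ × ℤ)) (n : ℕ) (hn : 1 ≤ n) :
    (T.filter fun a => supNorm a = n).card ≤ 12 * n := by
  classical
  set I : Finset ℤ := Finset.Icc (-(n : ℤ)) n with hI
  set P : Finset ℤ := {(n : ℤ), -(n : ℤ)} with hP
  have hsub : (T.filter fun a => supNorm a = n) ⊆ (P ×ˢ I) ∪ (I ×ˢ P) := by
    intro a ha
    have h := (Finset.mem_filter.1 ha).2
    simp only [supNorm] at h
    simp only [hI, hP, Finset.mem_union, Finset.mem_product, Finset.mem_insert,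
      Finset.mem_singleton, Finset.mem_Icc]
    omega
  refine (Finset.card_le_card hsub).trans ((Finset.card_union_le _ _).trans ?_)
  rw [Finset.card_product, Finset.card_product]
  have h1 : I.card ≤ 2 * n + 1 := by rw [hI, Int.card_Icc]; omega
  have h2 : P.card ≤ 2 := Finset.card_le_two
  nlinarith

/-- There are `O(q)` pairs of norm `q`, so the generic cost `ψ(q)^s q^{1-s}` of a pair is summable. -/
theorem summable_supNorm {ψ : ℕ → ℝ} (hψ : IsApproximatingFunction ψ) {s : ℝ}
    (hs1 : s < 1) (hsum : Summable fun n : ℕ => ψ n ^ s * (n : ℝ) ^ (2 - s)) :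
    Summable fun a : ℤ × ℤ => if 1 ≤ supNorm a then
      ψ (supNorm a) ^ s * (supNorm a : ℝ) ^ (1 - s) else 0 := by
  classical
  have hnn : ∀ n : ℕ, 0 ≤ ψ n ^ s * (n : ℝ) ^ (2 - s) := by
    intro n
    rcases Nat.eq_zero_or_pos n with rfl | hn
    · rw [Nat.cast_zero, Real.zero_rpow (by linarith), mul_zero]
    · have := (hψ.pos n hn).le
      positivity
  refine summable_of_sum_le (c := 12 * ∑' n : ℕ, ψ n ^ s * (n : ℝ) ^ (2 - s)) ?_ ?_
  · intro a
    simp only [Pi.zero_apply]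
    split_ifs with h
    · have := (hψ.pos _ h).le
      positivity
    · exact le_rfl
  · intro T
    rw [← Finset.sum_fiberwise_of_maps_to (fun a ha => Finset.mem_image_of_mem supNorm ha)]
    calc _ ≤ ∑ n ∈ T.image supNorm, 12 * (ψ n ^ s * (n : ℝ) ^ (2 - s)) := by
          refine Finset.sum_le_sum fun n _ => ?_
          rcases Nat.eq_zero_or_pos n with rfl | hn
          · rw [Finset.sum_eq_zero]
            · exact mul_nonneg (by norm_num) (hnn 0)
            · intro a ha
              rw [(Finset.mem_filter.1 ha).2, if_neg (by norm_num)]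
          · have hnR : (0 : ℝ) < n := by exact_mod_cast hn
            have hψn := hψ.pos n hn
            have e1 : ∀ a ∈ T.filter (fun a => supNorm a = n), (if 1 ≤ supNorm a then
                ψ (supNorm a) ^ s * (supNorm a : ℝ) ^ (1 - s) else 0)
                = ψ n ^ s * (n : ℝ) ^ (1 - s) := by
              intro a ha
              rw [(Finset.mem_filter.1 ha).2, if_pos (show 1 ≤ n from hn)]
            rw [Finset.sum_congr rfl e1, Finset.sum_const, nsmul_eq_mul]
            have e2 : ((T.filter fun a => supNorm a = n).card : ℝ) ≤ 12 * n := by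
              exact_mod_cast card_filter_supNorm_le T n hn
            have e3 : (n : ℝ) ^ (2 - s) = (n : ℝ) ^ (1 - s) * n := by
              have : (2 : ℝ) - s = (1 - s) + 1 := by ring
              rw [this, Real.rpow_add_one hnR.ne']
            rw [e3]
            calc _ ≤ 12 * n * (ψ n ^ s * (n : ℝ) ^ (1 - s)) := by gcongr
              _ = _ := by ring
      _ = 12 * ∑ n ∈ T.image supNorm, ψ n ^ s * (n : ℝ) ^ (2 - s) := by rw [Finset.mul_sum]
      _ ≤ _ := by
          gcongr
          exact hsum.sum_le_tsum _ fun i _ => hnn i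

open scoped Classical in
/-- The near pairs contribute a convergent sum: those with `2^(k-1) ≤ |a| < 2^k` number at most
`O(2^{3k/2} β^{-k})` and contribute `O(2^{-3k/2})` each. -/
theorem summable_nearPairs {A B C : ℝ} {f f₁ l l₁ : ℝ → ℝ} (hf : IsConvexArc A B C f f₁)
    (hl : IsC11 A B C l l₁) (hAB : A ≤ B) {β K : ℝ} (hβ1 : 1 < β) (hβ : β ^ 29 ≤ √2) (hK : 0 ≤ K)
    (v : ℕ → ℝ) (hv0 : ∀ n, 1 ≤ n → 0 ≤ v n) (hv : ∀ n, 1 ≤ n → v n ≤ K / √n ^ 3) :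
    Summable fun a : ℤ × ℤ => if 1 ≤ supNorm a ∧ a ∈ nearPairs A B f f₁ l l₁
      (2 ^ (supNorm a).size) (1 / (100 * C) / (β ^ (supNorm a).size) ^ 2 / 2 ^ (supNorm a).size)
      then v (supNorm a) else 0 := by
  classical
  have hC := hf.one_le
  have hβ0 : 0 < β := by linarith
  have hs2 : 1 ≤ √2 := Real.one_le_sqrt.2 (by norm_num)
  have hgeo : Summable fun k : ℕ => (β⁻¹) ^ k :=
    summable_geometric_of_lt_one (by positivity) (inv_lt_one_of_one_lt₀ hβ1)
  refine summable_of_sum_le (c := 400000 * C ^ 5 * (3 * K) * ∑' k : ℕ, (β⁻¹) ^ k) ?_ ?_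
  · intro a
    simp only [Pi.zero_apply]
    split_ifs with h
    · exact hv0 _ h.1
    · exact le_rfl
  intro T
  rw [← Finset.sum_filter,
    ← Finset.sum_fiberwise_of_maps_to (fun a ha => Finset.mem_image_of_mem
      (fun a => (supNorm a).size) ha)]
  set T' := T.filter fun a => 1 ≤ supNorm a ∧ a ∈ nearPairs A B f f₁ l l₁
      (2 ^ (supNorm a).size) (1 / (100 * C) / (β ^ (supNorm a).size) ^ 2 / 2 ^ (supNorm a).size)
    with hT'
  calc _ ≤ ∑ k ∈ T'.image fun a => (supNorm a).size, 400000 * C ^ 5 * (3 * K) * (β⁻¹) ^ k := by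
        refine Finset.sum_le_sum fun k _ => ?_
        set w : ℝ := √2 ^ k with hw
        have hw0 : 0 < w := by positivity
        have hw2 : w ^ 2 = 2 ^ k := by
          rw [hw, ← pow_mul, mul_comm, pow_mul, Real.sq_sqrt (by norm_num)]
        have hcard : ((T'.filter fun a => (supNorm a).size = k).card : ℝ)
            ≤ 400000 * C ^ 5 * (w ^ 3 / β ^ k) := by
          refine card_nearPairs_le_div hf hl hAB (one_le_pow₀ hs2) (one_le_pow₀ hβ1.le) ?_ _ ?_
          · rw [← pow_mul, mul_comm, pow_mul]
            exact pow_le_pow_left₀ (by positivity) hβ k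
          · intro a ha
            obtain ⟨ha1, ha2⟩ := Finset.mem_filter.1 (Finset.mem_coe.1 ha)
            have := (Finset.mem_filter.1 ha1).2.2
            rw [hw2]
            rwa [ha2] at this
        have hval : ∀ a ∈ T'.filter (fun a => (supNorm a).size = k),
            v (supNorm a) ≤ 3 * K / w ^ 3 := by
          intro a ha
          obtain ⟨ha1, ha2⟩ := Finset.mem_filter.1 ha
          have hn := (Finset.mem_filter.1 ha1).2.1
          refine (hv _ hn).trans ?_
          have hsize : 2 ^ k ≤ 2 * supNorm a := by
            have hk0 : 0 < k := by rw [← ha2]; exact Nat.size_pos.2 hn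
            have : 2 ^ (k - 1) ≤ supNorm a := Nat.lt_size.1 (by omega)
            have hk : k = (k - 1) + 1 := by omega
            rw [hk, pow_succ]; omega
          have hsizeR : (2 : ℝ) ^ k ≤ 2 * supNorm a := by exact_mod_cast hsize
          set r := √(supNorm a : ℝ) with hr
          have hn0 : (0 : ℝ) < supNorm a := by exact_mod_cast hn
          have hr0 : 0 < r := Real.sqrt_pos.2 hn0
          have hr2 : r ^ 2 = supNorm a := Real.sq_sqrt hn0.le
          have hwr : w ^ 2 ≤ 2 * r ^ 2 := by rw [hw2, hr2]; exact hsizeR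
          have hwr' : w ≤ 1.42 * r := by
            refine abs_le_of_sq_le_sq' ?_ (by positivity) |>.2
            nlinarith
          have hwr3 : w ^ 3 ≤ 3 * r ^ 3 := by
            calc w ^ 3 = w ^ 2 * w := by ring
              _ ≤ 2 * r ^ 2 * (1.42 * r) := by gcongr
              _ = 2.84 * r ^ 3 := by ring
              _ ≤ 3 * r ^ 3 := by gcongr; norm_num
          rw [div_le_div_iff₀ (by positivity) (by positivity)]
          nlinarith
        calc _ ≤ ∑ a ∈ T'.filter (fun a => (supNorm a).size = k), 3 * K / w ^ 3 :=
              Finset.sum_le_sum hval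
          _ = (T'.filter fun a => (supNorm a).size = k).card * (3 * K / w ^ 3) := by
              rw [Finset.sum_const, nsmul_eq_mul]
          _ ≤ 400000 * C ^ 5 * (w ^ 3 / β ^ k) * (3 * K / w ^ 3) := by gcongr
          _ = _ := by rw [inv_pow]; field_simp
    _ = 400000 * C ^ 5 * (3 * K) * ∑ k ∈ T'.image fun a => (supNorm a).size, (β⁻¹) ^ k := by
        rw [Finset.mul_sum]
    _ ≤ _ := by
        gcongr
        exact hgeo.sum_le_tsum _ fun i _ => by positivity

/-! ### The theorem for a convex arc -/

/-- The points of `[A, B]` approximated infinitely often by the forms restricted to the graph of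
`f` and shifted by `l`. -/
def arcApproxSet (A B : ℝ) (f l : ℝ → ℝ) (ψ : ℕ → ℝ) : Set ℝ :=
  {x ∈ Icc A B | {p : ℤ × (ℤ × ℤ) | p.2 ≠ 0 ∧
    |(p.2.2 : ℝ) * f x + (p.2.1 : ℝ) * x + (p.1 : ℝ) + l x| < ψ (supNorm p.2)}.Infinite}

theorem finite_small_forms (f l : ℝ → ℝ) (ψ : ℕ → ℝ) (n₀ : ℕ) (x : ℝ) :
    {p : ℤ × (ℤ × ℤ) | supNorm p.2 < n₀ ∧
      |curveForm f l p.2 x + p.1| < ψ (supNorm p.2)}.Finite := by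
  have hbox : {a : ℤ × ℤ | supNorm a < n₀}.Finite := by
    refine (Finset.finite_toSet (Finset.Icc (-(n₀ : ℤ)) n₀ ×ˢ Finset.Icc (-(n₀ : ℤ)) n₀)).subset ?_
    intro a ha
    simp only [Set.mem_ofPred_eq, supNorm] at ha
    simp only [Finset.coe_product, Finset.coe_Icc, Set.mem_prod, Set.mem_Icc]
    omega
  refine (hbox.biUnion (t := fun a => (fun k : ℤ => (k, a)) ''
    {k : ℤ | |curveForm f l a x + k| < ψ (supNorm a)}) fun a _ => ?_).subset ?_
  · refine Set.Finite.image _ ?_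
    refine (Set.finite_Icc ⌊-(ψ (supNorm a)) - curveForm f l a x⌋
      ⌈ψ (supNorm a) - curveForm f l a x⌉).subset ?_
    intro k hk
    have := abs_lt.1 (show |curveForm f l a x + k| < ψ (supNorm a) from hk)
    refine ⟨?_, ?_⟩
    · exact_mod_cast (Int.floor_le _).trans (by linarith : _ ≤ (k : ℝ))
    · exact_mod_cast (by linarith : (k : ℝ) ≤ _).trans (Int.le_ceil _)
  · rintro p ⟨h1, h2⟩
    exact Set.mem_biUnion (x := p.2) h1 ⟨p.1, h2, rfl⟩

open scoped ENNReal in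
/-- If for all large pairs the sublevel sets have summable cost on either side of suitable points,
the approximated set is null. -/
theorem arcApproxSet_null_of_cost {A B s : ℝ} (hs0 : 0 < s) {f l : ℝ → ℝ} {ψ : ℕ → ℝ} {n₀ : ℕ}
    (cost : ℤ × ℤ → ℝ) (hcost : Summable cost)
    (h : ∀ a : ℤ × ℤ, n₀ ≤ supNorm a → ∃ z : ℝ, ∀ Side : Set ℝ, Side = Ici z ∨ Side = Iic z →
      ∑' a₀ : ℤ, Metric.ediam {x ∈ Icc A B | x ∈ Side ∧
        |curveForm f l a x + a₀| < ψ (supNorm a)} ^ s ≤ ENNReal.ofReal (cost a)) :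
    μH[s] (arcApproxSet A B f l ψ) = 0 := by
  classical
  choose! z hz using h
  let Side : Bool → ℤ × ℤ → Set ℝ := fun σ a => if σ then Ici (z a) else Iic (z a)
  let E : Bool × (ℤ × ℤ) × ℤ → Set ℝ := fun i => if n₀ ≤ supNorm i.2.1 then
    {x ∈ Icc A B | x ∈ Side i.1 i.2.1 ∧ |curveForm f l i.2.1 x + i.2.2| < ψ (supNorm i.2.1)} else ∅
  have hE : ∑' i, Metric.ediam (E i) ^ s ≠ ∞ := by
    rw [ENNReal.tsum_prod']
    have hσ : ∀ σ : Bool, ∑' p : (ℤ × ℤ) × ℤ, Metric.ediam (E (σ, p)) ^ s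
        ≤ ∑' a, ENNReal.ofReal (cost a) := by
      intro σ
      rw [ENNReal.tsum_prod']
      refine ENNReal.tsum_le_tsum fun a => ?_
      by_cases ha : n₀ ≤ supNorm a
      · simp only [E, if_pos ha]
        refine hz a ha _ ?_
        simp only [Side]
        cases σ <;> simp
      · simp only [E, if_neg ha, Metric.ediam_empty, ENNReal.zero_rpow_of_pos hs0, tsum_zero]
        exact bot_le
    refine ne_top_of_le_ne_top ?_ (ENNReal.tsum_le_tsum hσ)
    rw [tsum_fintype]
    exact ENNReal.sum_ne_top.2 fun _ _ => hcost.tsum_ofReal_ne_top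
  refine measure_mono_null ?_ (hausdorffMeasure_limsup_eq_zero hs0 E hE)
  rintro x ⟨hx, hinf⟩
  have hinf' := hinf.sdiff (finite_small_forms f l ψ n₀ x)
  refine Set.infinite_of_injOn_mapsTo
    (f := fun p : ℤ × (ℤ × ℤ) => (decide (z p.2 ≤ x), p.2, p.1)) ?_ ?_ hinf'
  · intro p _ p' _ hpp
    simp only [Prod.mk.injEq] at hpp
    exact Prod.ext hpp.2.2 hpp.2.1
  · rintro p ⟨⟨-, hp⟩, hp2⟩
    have hform : (p.2.2 : ℝ) * f x + (p.2.1 : ℝ) * x + (p.1 : ℝ) + l x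
        = curveForm f l p.2 x + p.1 := by simp only [curveForm]; ring
    rw [hform] at hp
    have hn : n₀ ≤ supNorm p.2 := by
      by_contra hlt
      exact hp2 ⟨not_le.1 hlt, hp⟩
    simp only [Set.mem_ofPred_eq, E, if_pos hn]
    refine ⟨hx, ?_, hp⟩
    simp only [Side]
    by_cases hzx : z p.2 ≤ x
    · simp [hzx]
    · simp [hzx, (not_le.1 hzx).le]

/-- The theorem for a convex arc. Pairs with `2^(k-1) ≤ |a| < 2^k` are treated with the parameters
`Q = 2^k` and `t = β^k`, `β > 1`. -/
theorem arcApproxSet_null {A B C s : ℝ} {f f₁ l l₁ : ℝ → ℝ} (hf : IsConvexArc A B C f f₁)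
    (hl : IsC11 A B C l l₁) (hAB : A ≤ B) (hs0 : 0 < s) (hs1 : s < 1) {ψ : ℕ → ℝ}
    (hψ : IsApproximatingFunction ψ)
    (hsum : Summable fun n : ℕ => ψ n ^ s * (n : ℝ) ^ (2 - s)) :
    μH[s] (arcApproxSet A B f l ψ) = 0 := by
  classical
  have hC := hf.one_le
  have hC0 : 0 < C := by linarith
  obtain ⟨K, hK0, hK⟩ := rpow_mul_rpow_bounded hψ hs0 hs1 hsum
  -- `t = β ^ k = Q ^ τ` for `Q = 2 ^ k`: the count of near pairs needs `29 τ ≤ 1 / 2`, and the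
  -- loss of `t ^ 2` in the length of the other sublevel sets is harmless for `2 τ s ≤ 1 - s`
  set τ : ℝ := (1 - s) / 60 with hτ
  set β : ℝ := 2 ^ τ with hβdef
  have hτ0 : 0 < τ := by rw [hτ]; linarith
  have hβ1 : 1 < β := Real.one_lt_rpow (by norm_num) hτ0
  have hβ29 : β ^ 29 ≤ √2 := by
    rw [hβdef, ← Real.rpow_natCast, ← Real.rpow_mul (by norm_num), Real.sqrt_eq_rpow]
    refine Real.rpow_le_rpow_of_exponent_le (by norm_num) ?_
    rw [hτ]; push_cast; linarith
  have hβs : (β ^ 2) ^ s ≤ 2 ^ (1 - s) := by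
    rw [hβdef, ← Real.rpow_natCast, ← Real.rpow_mul (by positivity), ← Real.rpow_mul (by positivity)]
    refine Real.rpow_le_rpow_of_exponent_le (by norm_num) ?_
    rw [hτ]; push_cast; nlinarith
  have hβ4 : β ^ 4 ≤ 2 := by
    calc β ^ 4 ≤ β ^ 29 := pow_le_pow_right₀ hβ1.le (by norm_num)
      _ ≤ √2 := hβ29
      _ ≤ 2 := by rw [Real.sqrt_le_left (by norm_num)]; norm_num
  -- `ψ(n) n² → 0`
  have hdecay : ∀ᶠ n : ℕ in atTop, ψ n * (n : ℝ) ^ 2 ≤ 1 / (80000 * C ^ 2) := by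
    have h1 : Tendsto (fun n : ℕ => K * (n : ℝ) ^ (-(3 * (1 - s)))) atTop (𝓝 (K * 0)) :=
      ((tendsto_rpow_neg_atTop (by linarith : 0 < 3 * (1 - s))).comp
        tendsto_natCast_atTop_atTop).const_mul K
    rw [mul_zero] at h1
    have h2 : 0 < (1 / (80000 * C ^ 2)) ^ s := by positivity
    filter_upwards [h1.eventually (eventually_le_nhds h2), eventually_ge_atTop 1] with n hn hn1
    have hnR : (0 : ℝ) < n := by exact_mod_cast hn1
    have hψn := hψ.pos n hn1
    have h3 : (ψ n * (n : ℝ) ^ 2) ^ s ≤ (1 / (80000 * C ^ 2)) ^ s := by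
      refine le_trans ?_ hn
      rw [Real.mul_rpow hψn.le (by positivity), ← Real.rpow_natCast, ← Real.rpow_mul hnR.le]
      have e1 : (n : ℝ) ^ (((2 : ℕ) : ℝ) * s)
          = (n : ℝ) ^ (3 - s) * (n : ℝ) ^ (-(3 * (1 - s))) := by
        rw [← Real.rpow_add hnR]; congr 1; push_cast; ring
      rw [e1, ← mul_assoc]
      gcongr
      exact hK n hn1
    exact (Real.rpow_le_rpow_iff (by positivity) (by positivity) hs0).1 h3
  obtain ⟨n₁, hn₁⟩ := eventually_atTop.1 (hdecay.and
    (hψ.tendsto_zero.eventually (eventually_le_nhds (by norm_num : (0 : ℝ) < 1 / 4))))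
  set n₀ : ℕ := max n₁ (max ⌈6 * C ^ 3⌉₊ 1) with hn₀
  have S1 := (summable_supNorm hψ hs1 hsum).mul_left (3000 * C ^ 3)
  have S2 := summable_nearPairs hf hl hAB hβ1 hβ29
    (by positivity : 0 ≤ 24 * C ^ 2 * √K) (fun n => 24 * C ^ 2 * (ψ n / n) ^ (s / 2))
    (fun n hn => by have := hψ.pos n hn; positivity) (fun n hn => by
      have hnR : (0 : ℝ) < n := by exact_mod_cast hn
      have hψn := hψ.pos n hn
      have e1 : (ψ n / n) ^ s ≤ K / (n : ℝ) ^ 3 := by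
        rw [le_div_iff₀ (by positivity)]
        calc (ψ n / n) ^ s * (n : ℝ) ^ 3 = ψ n ^ s * (n : ℝ) ^ (3 - s) := by
              rw [Real.div_rpow hψn.le hnR.le, Real.rpow_sub hnR]
              norm_cast
              ring
          _ ≤ K := hK n hn
      have e2 : (ψ n / n) ^ (s / 2) = √((ψ n / n) ^ s) := by
        rw [Real.sqrt_eq_rpow, ← Real.rpow_mul (by positivity)]; congr 1; ring
      have e3 : √(n : ℝ) ^ 3 = √((n : ℝ) ^ 3) := by
        rw [Real.sqrt_eq_rpow, Real.sqrt_eq_rpow, ← Real.rpow_natCast, ← Real.rpow_natCast,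
          ← Real.rpow_mul hnR.le, ← Real.rpow_mul hnR.le]
        congr 1; ring
      rw [e2, e3, mul_div_assoc, ← Real.sqrt_div hK0.le]
      gcongr)
  refine arcApproxSet_null_of_cost hs0 (n₀ := n₀) _ (S1.add S2) fun a ha => ?_
  set n := supNorm a with hn
  have hn1 : 1 ≤ n := by omega
  have hnR : (1 : ℝ) ≤ n := by exact_mod_cast hn1
  have hψn := hψ.pos n hn1
  obtain ⟨hd1, hd2⟩ := hn₁ n (by omega)
  have hC3 : 6 * C ^ 3 ≤ (n : ℝ) :=
    (Nat.le_ceil _).trans (by exact_mod_cast (by omega : ⌈6 * C ^ 3⌉₊ ≤ n))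
  have hQ1 : (n : ℝ) ≤ 2 ^ n.size := by exact_mod_cast (Nat.lt_size_self n).le
  have hQ2 : (2 : ℝ) ^ n.size ≤ 2 * n := by
    have hk0 : 0 < n.size := Nat.size_pos.2 hn1
    have h1 : 2 ^ (n.size - 1) ≤ n := Nat.lt_size.1 (by omega)
    have h2 : 2 ^ n.size = 2 ^ (n.size - 1) * 2 := by rw [← pow_succ]; congr 1; omega
    have : 2 ^ n.size ≤ 2 * n := by omega
    exact_mod_cast this
  have ht4 : (β ^ n.size) ^ 4 ≤ 2 ^ n.size := by
    rw [← pow_mul, mul_comm, pow_mul]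
    exact pow_le_pow_left₀ (by positivity) hβ4 _
  have hts : ((β ^ n.size) ^ 2) ^ s ≤ 2 * (n : ℝ) ^ (1 - s) := by
    have e1 : ((β ^ n.size) ^ 2) ^ s = ((β ^ 2) ^ s) ^ n.size := by
      rw [← pow_mul, mul_comm, pow_mul, ← Real.rpow_natCast, ← Real.rpow_mul (by positivity),
        mul_comm, Real.rpow_mul (by positivity), Real.rpow_natCast]
    have e2 : ((2 : ℝ) ^ (1 - s)) ^ n.size = ((2 : ℝ) ^ n.size) ^ (1 - s) := by
      rw [← Real.rpow_natCast, ← Real.rpow_mul (by norm_num), mul_comm,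
        Real.rpow_mul (by norm_num), Real.rpow_natCast]
    calc ((β ^ n.size) ^ 2) ^ s = ((β ^ 2) ^ s) ^ n.size := e1
      _ ≤ ((2 : ℝ) ^ (1 - s)) ^ n.size := pow_le_pow_left₀ (by positivity) hβs _
      _ = ((2 : ℝ) ^ n.size) ^ (1 - s) := e2
      _ ≤ (2 * (n : ℝ)) ^ (1 - s) := Real.rpow_le_rpow (by positivity) hQ2 (by linarith)
      _ = 2 ^ (1 - s) * (n : ℝ) ^ (1 - s) := Real.mul_rpow (by norm_num) (by linarith)
      _ ≤ 2 * (n : ℝ) ^ (1 - s) := by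
        gcongr; exact rpow_le_self_of_le_one (by norm_num) (by linarith)
  have hψ2 : 2 * ψ n ≤ 2 ^ n.size * (1 / (100 * C) / (β ^ n.size) ^ 2 / 2 ^ n.size) ^ 2 := by
    have e1 : (2 : ℝ) ^ n.size * (1 / (100 * C) / (β ^ n.size) ^ 2 / 2 ^ n.size) ^ 2
        = 1 / (10000 * C ^ 2 * ((β ^ n.size) ^ 4 * 2 ^ n.size)) := by
      field_simp; norm_num
    have e2 : (β ^ n.size) ^ 4 * 2 ^ n.size ≤ 4 * (n : ℝ) ^ 2 := by
      calc (β ^ n.size) ^ 4 * 2 ^ n.size ≤ 2 ^ n.size * 2 ^ n.size := by gcongr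
        _ ≤ (2 * n) * (2 * n) := by gcongr
        _ = _ := by ring
    rw [e1, le_div_iff₀ (by positivity)]
    rw [le_div_iff₀ (by positivity)] at hd1
    calc 2 * ψ n * (10000 * C ^ 2 * ((β ^ n.size) ^ 4 * 2 ^ n.size))
        ≤ 2 * ψ n * (10000 * C ^ 2 * (4 * (n : ℝ) ^ 2)) := by gcongr
      _ = ψ n * (n : ℝ) ^ 2 * (80000 * C ^ 2) := by ring
      _ ≤ 1 := hd1
  obtain ⟨z, hz⟩ := tsum_ediam_le hf hl hAB hs0 hs1 a hC3 hψn hd2 (Q := 2 ^ n.size)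
    (t := β ^ n.size) hQ1 hQ2 (one_le_pow₀ hβ1.le) hts hψ2
  refine ⟨z, fun Side hSide => (hz Side hSide).trans (ENNReal.ofReal_le_ofReal (le_of_eq ?_))⟩
  rw [if_pos hn1]
  congr 1
  by_cases hnear : a ∈ nearPairs A B f f₁ l l₁ (2 ^ n.size)
      (1 / (100 * C) / (β ^ n.size) ^ 2 / 2 ^ n.size)
  · rw [Set.indicator_of_mem (by exact hnear), if_pos ⟨hn1, hnear⟩]
  · rw [Set.indicator_of_notMem (by exact hnear), if_neg fun h => hnear h.2]

/-! ### Localization -/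

theorem hasDerivWithinAt_twice {α β : ℝ} (hαβ : α < β) {l : ℝ → ℝ}
    (hl : ContDiffOn ℝ 2 l (Icc α β)) :
    (∀ x ∈ Icc α β, HasDerivWithinAt l (derivWithin l (Icc α β) x) (Icc α β) x) ∧
    (∀ x ∈ Icc α β, HasDerivWithinAt (derivWithin l (Icc α β))
      (iteratedDerivWithin 2 l (Icc α β) x) (Icc α β) x) ∧
    ContinuousOn (iteratedDerivWithin 2 l (Icc α β)) (Icc α β) := by
  have hu := uniqueDiffOn_Icc hαβ
  have h1 : ContDiffOn ℝ 1 (derivWithin l (Icc α β)) (Icc α β) :=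
    hl.derivWithin hu (by norm_num)
  have h2 : iteratedDerivWithin 2 l (Icc α β)
      = derivWithin (derivWithin l (Icc α β)) (Icc α β) := by
    rw [iteratedDerivWithin_succ]
    congr 1
    exact iteratedDerivWithin_one
  refine ⟨fun x hx => ((hl.differentiableOn (by norm_num)) x hx).hasDerivWithinAt,
    fun x hx => ?_, ?_⟩
  · rw [h2]
    exact ((h1.differentiableOn (by norm_num)) x hx).hasDerivWithinAt
  · exact hl.continuousOn_iteratedDerivWithin (by norm_num) hu

theorem exists_isC11 {α β : ℝ} (hαβ : α < β) {l : ℝ → ℝ} (hl : ContDiffOn ℝ 2 l (Icc α β)) :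
    ∃ C₀ : ℝ, ∀ C, C₀ ≤ C → ∀ A B, Icc A B ⊆ Icc α β →
      IsC11 A B C l (derivWithin l (Icc α β)) := by
  obtain ⟨d1, d2, c2⟩ := hasDerivWithinAt_twice hαβ hl
  have c1 : ContinuousOn (derivWithin l (Icc α β)) (Icc α β) :=
    fun x hx => (d2 x hx).continuousWithinAt
  obtain ⟨M0, h0⟩ := isCompact_Icc.exists_bound_of_continuousOn hl.continuousOn
  obtain ⟨M1, h1⟩ := isCompact_Icc.exists_bound_of_continuousOn c1
  obtain ⟨M2, h2⟩ := isCompact_Icc.exists_bound_of_continuousOn c2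
  refine ⟨max M0 (max M1 M2), fun C hC A B hsub => ?_⟩
  obtain ⟨hC0, hC1, hC2⟩ : M0 ≤ C ∧ M1 ≤ C ∧ M2 ≤ C :=
    ⟨(le_max_left _ _).trans hC, ((le_max_left _ _).trans (le_max_right _ _)).trans hC,
      ((le_max_right _ _).trans (le_max_right _ _)).trans hC⟩
  refine ⟨fun x hx => (d1 x (hsub hx)).mono hsub, fun x hx => (h0 x (hsub hx)).trans hC0,
    fun x hx => (h1 x (hsub hx)).trans hC1, fun x hx y hy => ?_⟩
  exact (convex_Icc α β).norm_image_sub_le_of_norm_hasDerivWithin_le d2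
    (fun t ht => (h2 t ht).trans hC2) (hsub hy) (hsub hx)

/-- A point with `f'' > 0` has a neighbourhood in `[α, β]` that is a convex arc. -/
theorem exists_convexArc {α β : ℝ} (hαβ : α < β) {f l : ℝ → ℝ} (hf : ContDiffOn ℝ 2 f (Icc α β))
    (hl : ContDiffOn ℝ 2 l (Icc α β)) {x₀ : ℝ} (hx₀ : x₀ ∈ Icc α β)
    (hpos : 0 < iteratedDerivWithin 2 f (Icc α β) x₀) :
    ∃ A B C : ℝ, A ≤ B ∧ IsConvexArc A B C f (derivWithin f (Icc α β)) ∧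
      IsC11 A B C l (derivWithin l (Icc α β)) ∧ Icc A B ∈ 𝓝[Icc α β] x₀ := by
  obtain ⟨-, d2, c2⟩ := hasDerivWithinAt_twice hαβ hf
  obtain ⟨Cf, hCf⟩ := exists_isC11 hαβ hf
  obtain ⟨Cl, hCl⟩ := exists_isC11 hαβ hl
  set c := iteratedDerivWithin 2 f (Icc α β) x₀ / 2 with hc
  have hc0 : 0 < c := by linarith
  have hev : ∀ᶠ x in 𝓝[Icc α β] x₀, c < iteratedDerivWithin 2 f (Icc α β) x :=
    (c2 x₀ hx₀).eventually (lt_mem_nhds (by linarith))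
  obtain ⟨ε, hε, hball⟩ := Metric.mem_nhdsWithin_iff.1 hev
  set A := max α (x₀ - ε / 2) with hA
  set B := min β (x₀ + ε / 2) with hB
  have hAx : A ≤ x₀ := max_le hx₀.1 (by linarith)
  have hxB : x₀ ≤ B := le_min hx₀.2 (by linarith)
  have hsub : Icc A B ⊆ Icc α β := Icc_subset_Icc (le_max_left _ _) (min_le_left _ _)
  have hbig : ∀ x ∈ Icc A B, c < iteratedDerivWithin 2 f (Icc α β) x := by
    intro x hx
    refine hball ⟨?_, hsub hx⟩
    have h1 := (le_max_right α (x₀ - ε / 2)).trans hx.1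
    have h2 := hx.2.trans (min_le_right β (x₀ + ε / 2))
    rw [Metric.mem_ball, Real.dist_eq, abs_lt]
    constructor <;> linarith
  set C := max (max Cf Cl) (max (|α| + |β| + 1) (1 / c)) with hC
  have hC1 : Cf ≤ C := (le_max_left _ _).trans (le_max_left _ _)
  have hC2 : Cl ≤ C := (le_max_right _ _).trans (le_max_left _ _)
  have hC3 : |α| + |β| + 1 ≤ C := (le_max_left _ _).trans (le_max_right _ _)
  have hC4 : 1 / c ≤ C := (le_max_right _ _).trans (le_max_right _ _)
  refine ⟨A, B, C, hAx.trans hxB, ⟨hCf C hC1 A B hsub, ?_, fun x hx => ?_, ?_⟩,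
    hCl C hC2 A B hsub, ?_⟩
  · linarith [abs_nonneg α, abs_nonneg β]
  · have h1 := neg_abs_le α
    have h2 := le_abs_self β
    have h3 := hsub hx
    rw [abs_le]
    constructor <;> linarith [h3.1, h3.2, abs_nonneg α, abs_nonneg β]
  · intro x hx y hy hxy
    have hmon : MonotoneOn (fun t => derivWithin f (Icc α β) t - c * t) (Icc A B) := by
      refine monotoneOn_of_hasDerivWithinAt_nonneg
        (f' := fun t => iteratedDerivWithin 2 f (Icc α β) t - c) (convex_Icc A B) ?_ ?_ ?_
      · exact ContinuousOn.sub (fun t ht => ((d2 t (hsub ht)).mono hsub).continuousWithinAt)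
          (by fun_prop)
      · intro t ht
        have h1 := (d2 t (hsub (interior_subset ht))).mono (interior_subset.trans hsub)
        have h2 : HasDerivAt (fun t => c * t) c t := by
          simpa using (hasDerivAt_id t).const_mul c
        exact h1.sub h2.hasDerivWithinAt
      · intro t ht
        linarith [hbig t (interior_subset ht)]
    have h1 := hmon hx hy hxy
    simp only at h1
    have h2 : c * (y - x) ≤ derivWithin f (Icc α β) y - derivWithin f (Icc α β) x := by linarith
    have h3 : 1 ≤ C * c := by rwa [div_le_iff₀ hc0] at hC4
    calc y - x ≤ C * c * (y - x) := le_mul_of_one_le_left (by linarith) h3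
      _ = C * (c * (y - x)) := by ring
      _ ≤ _ := by
        gcongr
  · rw [mem_nhdsWithin]
    refine ⟨Ioo (x₀ - ε / 2) (x₀ + ε / 2), isOpen_Ioo, ⟨by linarith, by linarith⟩, ?_⟩
    rintro x ⟨h1, h2⟩
    exact ⟨max_le h2.1 h1.1.le, le_min h2.2 h1.2.le⟩

/-- Replacing `a₂` by `-a₂` reduces concave arcs to convex ones. -/
theorem arcApproxSet_subset_neg (A B : ℝ) (f l : ℝ → ℝ) (ψ : ℕ → ℝ) :
    arcApproxSet A B f l ψ ⊆ arcApproxSet A B (fun x => -f x) l ψ := by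
  rintro x ⟨hx, hinf⟩
  refine ⟨hx, Set.infinite_of_injOn_mapsTo
    (f := fun p : ℤ × (ℤ × ℤ) => (p.1, (p.2.1, -p.2.2))) ?_ ?_ hinf⟩
  · intro p _ p' _ hpp
    simp only [Prod.mk.injEq, neg_inj] at hpp
    exact Prod.ext hpp.1 (Prod.ext hpp.2.1 hpp.2.2)
  · rintro p ⟨hp0, hp⟩
    refine ⟨fun h => hp0 ?_, ?_⟩
    · simp only [Prod.mk_eq_zero, neg_eq_zero] at h
      exact Prod.ext h.1 h.2
    · have h1 : supNorm (p.2.1, -p.2.2) = supNorm p.2 := by simp [supNorm]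
      simp only [h1]
      push_cast
      rwa [neg_mul_neg]

theorem theorem5 (α β : ℝ) (hαβ : α < β) (s : ℝ) (hs0 : 0 < s) (hs1 : s < 1)
    (ψ : ℕ → ℝ) (hψ : IsApproximatingFunction ψ)
    (f : ℝ → ℝ) (hf : IsNondegenerateCurve s α β f)
    (lam : ℝ × ℝ → ℝ) (hlam : ContDiffOn ℝ 2 (fun x => lam (x, f x)) (Icc α β))
    (hsum : Summable (fun q : ℕ => ψ (q + 1) ^ s * ((q + 1 : ℕ) : ℝ) ^ (2 - s))) :
    μH[s] (dualApproxSet α β f lam ψ) = 0 := by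
  obtain ⟨hf2, hnull⟩ := hf
  have hsum' : Summable fun n : ℕ => ψ n ^ s * (n : ℝ) ^ (2 - s) :=
    (summable_nat_add_iff (f := fun n : ℕ => ψ n ^ s * (n : ℝ) ^ (2 - s)) 1).1 hsum
  set l : ℝ → ℝ := fun x => lam (x, f x) with hl
  set W := dualApproxSet α β f lam ψ with hW
  set Z := {x ∈ Icc α β | iteratedDerivWithin 2 f (Icc α β) x = 0} with hZ
  have hdiff : μH[s] (W \ Z) = 0 := by
    refine measure_null_of_locally_null _ fun x₀ hx₀ => ?_
    have hxI : x₀ ∈ Icc α β := hx₀.1.1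
    have hne : iteratedDerivWithin 2 f (Icc α β) x₀ ≠ 0 := fun h => hx₀.2 ⟨hxI, h⟩
    obtain ⟨A, B, hmem, hAB⟩ : ∃ A B : ℝ, Icc A B ∈ 𝓝[Icc α β] x₀ ∧
        μH[s] (arcApproxSet A B f l ψ) = 0 := by
      rcases lt_or_gt_of_ne hne with h | h
      · have hneg : iteratedDerivWithin 2 (fun x => -f x) (Icc α β) x₀
            = -iteratedDerivWithin 2 f (Icc α β) x₀ :=
          iteratedDerivWithin_fun_neg (n := 2) (f := f)
        obtain ⟨A, B, C, hAB, h1, h2, h3⟩ := exists_convexArc hαβ hf2.neg hlam hxI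
          (by rw [hneg]; linarith)
        exact ⟨A, B, h3, measure_mono_null (arcApproxSet_subset_neg A B f l ψ)
          (arcApproxSet_null h1 h2 hAB hs0 hs1 hψ hsum')⟩
      · obtain ⟨A, B, C, hAB, h1, h2, h3⟩ := exists_convexArc hαβ hf2 hlam hxI h
        exact ⟨A, B, h3, arcApproxSet_null h1 h2 hAB hs0 hs1 hψ hsum'⟩
    refine ⟨Icc A B ∩ (W \ Z), Filter.inter_mem ?_ self_mem_nhdsWithin,
      measure_mono_null ?_ hAB⟩
    · exact nhdsWithin_mono x₀ (fun x hx => hx.1.1) hmem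
    · rintro x ⟨hx, hxW, -⟩
      exact ⟨hx, hxW.2⟩
  refine measure_mono_null (fun x hx => ?_) (measure_union_null hdiff hnull)
  by_cases hxZ : x ∈ Z
  · exact Or.inr hxZ
  · exact Or.inl ⟨hx, hxZ⟩
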